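/- Let $Y$ be a compact connected oriented $C^\infty$ surface (without boundary, of any genus), let $S\subset Y$ be a finite set of points, and let $N\ge 2$ be an integer. Then there are a compact connected oriented $C^\infty$ surface $Z$ and a ramified covering $\varphi: Z\to Y$ of degree $N$ such that: 1. $\varphi$ is orientation preserving; 2. $\varphi$ is totally ramified over every point of $S$; 3. the group $\mathrm{Aut}(Z/Y)$ of automorphisms of $Z$ over the identity map of $Y$ is isomorphic to $\mathbb{Z}/N\mathbb{Z}$ and acts transitively on the fibers of $\varphi$. This holds for the group of diffeomorphisms $h$ of $Z$ with $\varphi\circ h=\varphi$ and, for every choice of complex structures on $Z$ and $Y$ for which $\varphi$ is holomorphic, also for the group of biholomorphic maps $h: Z\to Z$ with $\varphi\circ h=\varphi$. Here a ramified covering of degree $N$ is a smooth surjective map $\varphi$ which near every point $x\in Z$ has the form $w\mapsto w^k$ in suitable smooth complex-valued coordinates centred at $x$ and at $\varphi(x)$, for some integer $k\ge 1$ (the ramification index of $\varphi$ at $x$), and which restricts to an $N$-sheeted covering over the complement of a finite subset of $Y$; ramification over points outside $S$ is allowed. It is totally ramified over $p$ if $\varphi^{-1}(p)$ is a single point, with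 ramification index $N$. It is orientation preserving if its differential preserves orientation wherever it is invertible. -/

import Mathlib

open Set Filter Topology
open scoped Manifold ContDiff

universe u

namespace RamifiedCovering

/-- The plane `ℝ²`, on which smooth surfaces are modelled. -/
abbrev Plane : Type := EuclideanSpace ℝ (Fin 2)

/-- The standard identification `(a, b) ↦ a + b i` of `ℝ²` with `ℂ`. -/
def toComplex (v : Plane) : ℂ := ⟨v 0, v 1⟩

/-- An orientation of a smooth surface, given by an oriented atlas: a set of charts of the smooth
structure that cover the surface, all of whose coordinate changes have positive Jacobian
determinant. -/
structure SurfaceOrientation (M : Type*) [TopologicalSpace M] [ChartedSpace Plane M] where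
  /-- the positively oriented charts -/
  charts : Set (OpenPartialHomeomorph M Plane)
  smooth : charts ⊆ IsManifold.maximalAtlas (𝓡 2) ∞ M
  cover : ∀ x : M, ∃ e ∈ charts, x ∈ e.source
  compatible : ∀ e ∈ charts, ∀ e' ∈ charts, ∀ x ∈ e.source ∩ e'.source,
    0 < (fderiv ℝ (e' ∘ e.symm) (e x)).det

section Maps

variable {Z Y : Type*} [TopologicalSpace Z] [ChartedSpace Plane Z]
  [TopologicalSpace Y] [ChartedSpace Plane Y]

/-- `φ` has the local form `w ↦ w ^ k` at `x` in smooth charts centred at `x` and at `φ x`, that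
is, `φ` has ramification index `k` at `x`. (The number `k` is unique.) -/
def HasRamificationIndex (φ : Z → Y) (x : Z) (k : ℕ) : Prop :=
  1 ≤ k ∧
  ∃ e ∈ IsManifold.maximalAtlas (𝓡 2) ∞ Z, ∃ e' ∈ IsManifold.maximalAtlas (𝓡 2) ∞ Y,
    x ∈ e.source ∧ φ x ∈ e'.source ∧ e x = 0 ∧ e' (φ x) = 0 ∧
    ∀ᶠ z in 𝓝 x, toComplex (e' (φ z)) = toComplex (e z) ^ k

/-- `φ : Z → Y` is a ramified covering of degree `N` of smooth surfaces (`Y` compact): `φ` is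
smooth and surjective, it has the form `w ↦ w ^ k` near every point, and away from finitely many
points of `Y` it is a covering map with `N` sheets. -/
structure IsRamifiedCovering (φ : Z → Y) (N : ℕ) : Prop where
  contMDiff : ContMDiff (𝓡 2) (𝓡 2) ∞ φ
  surjective : Function.Surjective φ
  exists_index : ∀ x : Z, ∃ k : ℕ, HasRamificationIndex φ x k
  covering : ∃ B : Set Y, B.Finite ∧ IsCoveringMapOn φ Bᶜ ∧ ∀ y ∈ Bᶜ, (φ ⁻¹' {y}).ncard = N

/-- `φ` is totally ramified over `p`: the fibre over `p` is a single point, at which the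
ramification index is the degree `N`. -/
def IsTotallyRamifiedOver (φ : Z → Y) (N : ℕ) (p : Y) : Prop :=
  ∃ x : Z, φ ⁻¹' {p} = {x} ∧ HasRamificationIndex φ x N

/-- `φ` preserves orientations: wherever its differential is invertible, its Jacobian determinant
in positively oriented charts is positive. -/
def IsOrientationPreserving (oZ : SurfaceOrientation Z) (oY : SurfaceOrientation Y)
    (φ : Z → Y) : Prop :=
  ∀ e ∈ oZ.charts, ∀ e' ∈ oY.charts, ∀ x ∈ e.source, φ x ∈ e'.source →
    (fderiv ℝ (e' ∘ φ ∘ e.symm) (e x)).det ≠ 0 →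
    0 < (fderiv ℝ (e' ∘ φ ∘ e.symm) (e x)).det

end Maps

/-- The automorphism group `Aut(Z/Y)` of `φ : Z → Y`, where `Z` is a manifold of class `C^n` with
model `I`: the homeomorphisms `h` of `Z` with `φ ∘ h = φ` such that `h` and its inverse are of
class `C^n`. For `I = 𝓡 2`, `n = ∞` these are the diffeomorphisms of `Z` over `Y`; for
`I = 𝓘(ℂ)`, `n = ω` they are the holomorphic automorphisms of `Z` over `Y`. -/
def Aut {𝕜 E H Z Y : Type*} [NontriviallyNormedField 𝕜] [NormedAddCommGroup E] [NormedSpace 𝕜 E]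
    [TopologicalSpace H] (I : ModelWithCorners 𝕜 E H) (n : WithTop ℕ∞)
    [TopologicalSpace Z] [ChartedSpace H Z] (φ : Z → Y) : Subgroup (Z ≃ₜ Z) where
  carrier := {h | ContMDiff I I n h ∧ ContMDiff I I n h.symm ∧ ∀ z, φ (h z) = φ z}
  one_mem' := ⟨contMDiff_id, contMDiff_id, fun _ => rfl⟩
  mul_mem' := fun {a b} ha hb =>
    ⟨ha.1.comp hb.1, hb.2.1.comp ha.2.1, fun z => (ha.2.2 (b z)).trans (hb.2.2 z)⟩
  inv_mem' := fun {a} ha => ⟨ha.2.1, ha.1, fun z => by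
    have := ha.2.2 (a.symm z)
    rw [Homeomorph.apply_symm_apply] at this
    exact this.symm⟩

/-- The group `G` of homeomorphisms of `Z` is isomorphic to `ℤ/Nℤ` and acts transitively on every
fibre of `φ`. -/
def IsCyclicGalois {Z Y : Type*} [TopologicalSpace Z] (φ : Z → Y) (N : ℕ)
    (G : Subgroup (Z ≃ₜ Z)) : Prop :=
  Nonempty (G ≃* Multiplicative (ZMod N)) ∧ ∀ z z' : Z, φ z = φ z' → ∃ h ∈ G, h z = z'

end RamifiedCovering

/-!
# Cyclic ramified coverings with prescribed total ramification

The covering surface is the surface `Z` of `N`-th roots of a smooth function `f : Y → ℂ`, that is,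
the set of pairs `(y, w)` in `Y × ℂ` with `w ^ N = f y`, projected to `Y`.

The function is chosen with finitely many zeros, among them the points of `S` and at least one, and
so that its differential is invertible at each zero. No global information on `Y` is needed for
this: inside a small disc around a point `p` the constant function `1` can be modified to have
exactly two zeros, `p` and a neighbour of it, with opposite local degrees
(`exists_dipole_function`), and a finite product of such modifications gives `f`
(`exists_isBranchFunction`). Since `f` or its complex conjugate is a positive coordinate near each
zero, `w` or its conjugate is a coordinate of `Z` over the zero, in which the projection is
`w ↦ w ^ N`; elsewhere the coordinates of `Y` are local coordinates of `Z`. These charts make up a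
smooth oriented atlas, because both the inclusion of `Z` in `Y × ℂ` and its local inverses are
smooth in them.

The surface `Z` is connected because a nonempty open and closed subset maps onto `Y`, hence contains
the single point over a zero of `f` (`RootSurface.connectedSpace`). The `N`-th roots of unity act on
`Z` by multiplication of `w`, transitively on the fibres. A homeomorphism over `Y` is locally one of
these multiplications, even near a ramification point, since punctured discs are connected; hence it
is one of them globally (`RootSurface.exists_eq_deck`). So every group of homeomorphisms over `Y`
that contains the multiplications is cyclic of order `N`. For the holomorphic automorphisms it
remains to see that the multiplications are holomorphic for every complex structure for which the
projection is: every homeomorphism over a holomorphic map with finite fibres is holomorphic, by the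
inverse function theorem and removal of singularities (`contMDiff_of_comp_eq`).
-/

namespace RamifiedCovering

/-! ### The plane and its power maps -/

/-- The identification `toComplex` of `ℝ²` with `ℂ`, as a continuous linear equivalence. -/
noncomputable def planeEquiv : Plane ≃L[ℝ] ℂ :=
  Complex.orthonormalBasisOneI.repr.symm.toContinuousLinearEquiv

lemma planeEquiv_apply (v : Plane) : planeEquiv v = toComplex v := by
  have h : planeEquiv v = Complex.orthonormalBasisOneI.repr.symm v := rfl
  rw [h, ← Complex.orthonormalBasisOneI.sum_repr_symm]
  simp [toComplex, Complex.ext_iff]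

/-- The map `w ↦ w ^ N` of `ℂ`, read in the plane. -/
noncomputable def planePow (N : ℕ) (v : Plane) : Plane := planeEquiv.symm (planeEquiv v ^ N)

lemma contDiff_planePow (N : ℕ) : ContDiff ℝ ∞ (planePow N) := by
  unfold planePow
  fun_prop

/-- The Jacobian determinant of `w ↦ w ^ N` is `|N w ^ (N - 1)| ^ 2`. -/
lemma det_fderiv_planePow_pos {N : ℕ} (hN : N ≠ 0) {v : Plane} (hv : v ≠ 0) :
    0 < (fderiv ℝ (planePow N) v).det := by
  set c : ℂ := N * planeEquiv v ^ (N - 1) with hc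
  have hc0 : c ≠ 0 := mul_ne_zero (Nat.cast_ne_zero.2 hN)
    (pow_ne_zero _ ((map_ne_zero_iff _ planeEquiv.injective).2 hv))
  have h1 : HasFDerivAt (fun w : ℂ => w ^ N)
      ((ContinuousLinearMap.toSpanSingleton ℂ c).restrictScalars ℝ) (planeEquiv v) :=
    (hasDerivAt_pow N (planeEquiv v)).hasFDerivAt.restrictScalars ℝ
  have h2 : HasFDerivAt (planePow N) _ v :=
    planeEquiv.symm.hasFDerivAt.comp v (h1.comp v planeEquiv.hasFDerivAt)
  rw [h2.fderiv]
  have h3 := LinearMap.det_conj (LinearMap.mulLeft ℝ c) planeEquiv.symm.toLinearEquiv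
  have h4 : LinearMap.det (LinearMap.mulLeft ℝ c) = Complex.normSq c := by
    rw [← Algebra.norm_complex_apply, Algebra.norm_apply]
    rfl
  refine lt_of_lt_of_eq (Complex.normSq_pos.2 hc0) ?_
  rw [← h4, ← h3]
  refine congrArg LinearMap.det (LinearMap.ext fun w => ?_)
  change planeEquiv.symm (c * planeEquiv w) = planeEquiv.symm (planeEquiv w • c)
  rw [smul_eq_mul, mul_comm]

/-! ### Changes of charts -/

lemma transition_comp {M X : Type*} [TopologicalSpace M] (F : M → X)
    {e e' : OpenPartialHomeomorph M Plane} {x : M}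
    (hx : x ∈ e.source) (hx' : x ∈ e'.source) :
    F ∘ e.symm =ᶠ[𝓝 (e x)] (F ∘ e'.symm) ∘ (e' ∘ e.symm) := by
  have : ∀ᶠ v in 𝓝 (e x), e.symm v ∈ e'.source :=
    (e.continuousAt_symm (e.map_source hx)).eventually
      (by rw [e.left_inv hx]; exact e'.open_source.mem_nhds hx')
  filter_upwards [this] with v hv
  simp [e'.left_inv hv]

section Charts

variable {M : Type*} [TopologicalSpace M] [ChartedSpace Plane M]

lemma contDiffAt_transition {e e' : OpenPartialHomeomorph M Plane}
    (he : e ∈ IsManifold.maximalAtlas (𝓡 2) ∞ M) (he' : e' ∈ IsManifold.maximalAtlas (𝓡 2) ∞ M)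
    {x : M} (hx : x ∈ e.source) (hx' : x ∈ e'.source) :
    ContDiffAt ℝ ∞ (e' ∘ e.symm) (e x) := by
  have h1 := contMDiffAt_symm_of_mem_maximalAtlas he (e.map_source hx)
  have h2 : ContMDiffAt (𝓡 2) (𝓡 2) ∞ e' (e.symm (e x)) :=
    contMDiffAt_of_mem_maximalAtlas he' (by rwa [e.left_inv hx])
  exact (h2.comp (e x) h1).contDiffAt

/-- The chain rule for the Jacobian determinant of a map `F` under a change of charts. -/
lemma det_fderiv_transition {F : M → Plane} {e e' : OpenPartialHomeomorph M Plane}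
    (he : e ∈ IsManifold.maximalAtlas (𝓡 2) ∞ M) (he' : e' ∈ IsManifold.maximalAtlas (𝓡 2) ∞ M)
    {x : M} (hx : x ∈ e.source) (hx' : x ∈ e'.source)
    (hF : DifferentiableAt ℝ (F ∘ e'.symm) (e' x)) :
    (fderiv ℝ (F ∘ e.symm) (e x)).det =
      (fderiv ℝ (F ∘ e'.symm) (e' x)).det * (fderiv ℝ (e' ∘ e.symm) (e x)).det := by
  have h1 : (e' ∘ e.symm) (e x) = e' x := by simp [e.left_inv hx]
  rw [(transition_comp F hx hx').fderiv_eq, fderiv_comp, h1]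
  · exact LinearMap.det_comp _ _
  · rwa [h1]
  · exact (contDiffAt_transition he he' hx hx').differentiableAt (by simp)

lemma det_transition_mul {e e' : OpenPartialHomeomorph M Plane}
    (he : e ∈ IsManifold.maximalAtlas (𝓡 2) ∞ M) (he' : e' ∈ IsManifold.maximalAtlas (𝓡 2) ∞ M)
    {x : M} (hx : x ∈ e.source) (hx' : x ∈ e'.source) :
    (fderiv ℝ (e ∘ e'.symm) (e' x)).det * (fderiv ℝ (e' ∘ e.symm) (e x)).det = 1 := by
  rw [← det_fderiv_transition he he' hx hx'
    ((contDiffAt_transition he' he hx' hx).differentiableAt (by simp))]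
  have : e ∘ e.symm =ᶠ[𝓝 (e x)] id := by
    filter_upwards [e.open_target.mem_nhds (e.map_source hx)] with v hv
    simp [e.right_inv hv]
  rw [this.fderiv_eq, fderiv_id]
  exact LinearMap.det_id

variable [IsManifold (𝓡 2) ∞ M]

/-- Composing a chart with a local diffeomorphism of the plane gives a chart. -/
lemma trans_mem_maximalAtlas {e : OpenPartialHomeomorph M Plane}
    (he : e ∈ IsManifold.maximalAtlas (𝓡 2) ∞ M) (R : OpenPartialHomeomorph Plane Plane)
    (hR : ∀ v ∈ e.target ∩ R.source, ContDiffAt ℝ ∞ R v)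
    (hR' : ∀ v ∈ e.target ∩ R.source, (fderiv ℝ R v).det ≠ 0) :
    e ≫ₕ R ∈ IsManifold.maximalAtlas (𝓡 2) ∞ M := by
  apply OpenPartialHomeomorph.mem_maximalAtlas_of_contMDiffOn
  · intro x hx
    simp only [mfld_simps] at hx
    refine ContMDiffAt.contMDiffWithinAt ?_
    exact (hR _ ⟨e.map_source hx.1, hx.2⟩).contMDiffAt.comp x
      (contMDiffAt_of_mem_maximalAtlas he hx.1)
  · intro v hv
    simp only [mfld_simps] at hv
    refine ContMDiffAt.contMDiffWithinAt ?_
    refine (contMDiffAt_symm_of_mem_maximalAtlas he hv.2).comp v (ContDiffAt.contMDiffAt ?_)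
    have hm : R.symm v ∈ e.target ∩ R.source := ⟨hv.2, R.map_target hv.1⟩
    refine R.contDiffAt_symm (f₀' := ContinuousLinearMap.toContinuousLinearEquivOfDetNeZero _
      (hR' _ hm)) hv.1 ?_ (hR _ hm)
    exact ((hR _ hm).differentiableAt (by simp)).hasFDerivAt

/-- Every point lies in the domain of a chart centred at it. -/
lemma exists_centered_chart (x : M) : ∃ e ∈ IsManifold.maximalAtlas (𝓡 2) ∞ M,
    x ∈ e.source ∧ e x = 0 := by
  let e := chartAt Plane x
  let R : OpenPartialHomeomorph Plane Plane := (Homeomorph.subRight (e x)).toOpenPartialHomeomorph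
  have hRR : (R : Plane → Plane) = fun v => v - e x := rfl
  refine ⟨e ≫ₕ R, trans_mem_maximalAtlas (IsManifold.chart_mem_maximalAtlas x) R ?_ ?_, ?_, ?_⟩
  · intro v _
    rw [hRR]; fun_prop
  · intro v _
    rw [hRR, fderiv_sub_const, fderiv_fun_id]
    have : (ContinuousLinearMap.id ℝ Plane).det = 1 := LinearMap.det_id
    simp [this]
  · simp [R, e]
  · simp [hRR]

end Charts

/-! ### The surface of `N`-th roots of a function -/

/-- The set of pairs `(y, w)` with `w ^ N = f y`: the Riemann surface of the `N`-th root of `f`. -/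
def RootSurface {Y : Type u} (f : Y → ℂ) (N : ℕ) : Type u := {z : Y × ℂ // z.2 ^ N = f z.1}

namespace RootSurface

variable {Y : Type u} {f : Y → ℂ} {N : ℕ}

/-- The projection `(y, w) ↦ y`. -/
def proj (z : RootSurface f N) : Y := z.1.1

/-- The tautological root `(y, w) ↦ w` of the function `f`. -/
def root (z : RootSurface f N) : ℂ := z.1.2

lemma root_pow (z : RootSurface f N) : root z ^ N = f (proj z) := z.2

lemma ext_proj_root {z z' : RootSurface f N} (h₁ : proj z = proj z') (h₂ : root z = root z') :
    z = z' := Subtype.ext (Prod.ext h₁ h₂)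

lemma root_eq_zero_iff (hN : N ≠ 0) (z : RootSurface f N) : root z = 0 ↔ f (proj z) = 0 := by
  rw [← root_pow z, pow_eq_zero_iff hN]

lemma proj_surjective (hN : N ≠ 0) : Function.Surjective (proj : RootSurface f N → Y) := fun y =>
  let ⟨w, hw⟩ := IsAlgClosed.exists_pow_nat_eq (f y) (Nat.pos_of_ne_zero hN)
  ⟨⟨(y, w), hw⟩, rfl⟩

lemma eq_of_root_eq_zero (hN : N ≠ 0) {z z' : RootSurface f N} (hz : root z = 0)
    (h : proj z' = proj z) : z' = z :=
  ext_proj_root h (by rw [hz, root_eq_zero_iff hN, h, ← root_eq_zero_iff hN, hz])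

lemma fiber_eq_singleton (hN : N ≠ 0) {z : RootSurface f N} (hz : root z = 0) :
    proj ⁻¹' {proj z} = {z} := by
  ext z'
  exact ⟨fun h => eq_of_root_eq_zero hN hz h, fun h => congrArg proj h⟩

/-- The map `(y, w) ↦ (y, ζ w)`, for an `N`-th root of unity `ζ`. -/
def mulRoot (ζ : rootsOfUnity N ℂ) (z : RootSurface f N) : RootSurface f N :=
  ⟨(proj z, (ζ : ℂˣ) * root z), by
    rw [mul_pow, (mem_rootsOfUnity' N (ζ : ℂˣ)).1 ζ.2, one_mul, root_pow]⟩

lemma mulRoot_mul (ζ ξ : rootsOfUnity N ℂ) (z : RootSurface f N) :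
    mulRoot (ζ * ξ) z = mulRoot ζ (mulRoot ξ z) :=
  ext_proj_root rfl (mul_assoc ((ζ : ℂˣ) : ℂ) ((ξ : ℂˣ) : ℂ) (root z))

lemma mulRoot_one (z : RootSurface f N) : mulRoot 1 z = z :=
  ext_proj_root rfl (one_mul (root z))

section Topological

variable [TopologicalSpace Y]

noncomputable instance : TopologicalSpace (RootSurface f N) := instTopologicalSpaceSubtype

lemma continuous_val : Continuous (fun z : RootSurface f N => (z.1 : Y × ℂ)) :=
  continuous_subtype_val

lemma continuous_proj : Continuous (proj : RootSurface f N → Y) :=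
  continuous_fst.comp continuous_val

lemma continuous_root : Continuous (root : RootSurface f N → ℂ) :=
  continuous_snd.comp continuous_val

instance [T2Space Y] : T2Space (RootSurface f N) :=
  inferInstanceAs (T2Space {z : Y × ℂ // z.2 ^ N = f z.1})

lemma compactSpace [CompactSpace Y] (hf : Continuous f) (hN : N ≠ 0) :
    CompactSpace (RootSurface f N) := by
  obtain ⟨C, hC⟩ := (isCompact_range hf).isBounded.exists_norm_le
  refine (isCompact_iff_compactSpace (X := Y × ℂ)).1
    (?_ : IsCompact {z : Y × ℂ | z.2 ^ N = f z.1})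
  refine IsCompact.of_isClosed_subset (isCompact_univ.prod (isCompact_closedBall (0 : ℂ) (max 1 C)))
    (isClosed_eq (by fun_prop) (by fun_prop)) fun z hz => ⟨mem_univ _, ?_⟩
  rw [mem_closedBall_zero_iff]
  by_contra! hlt
  have h1 : 1 ≤ ‖z.2‖ := (le_max_left _ _).trans hlt.le
  have h2 : ‖z.2‖ ^ N ≤ C := by
    rw [← norm_pow, show z.2 ^ N = f z.1 from hz]
    exact hC _ (mem_range_self _)
  exact absurd (((le_self_pow₀ h1 hN).trans h2).trans (le_max_right 1 C)) (not_le.2 hlt)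

/-! ### Deck transformations -/

lemma continuous_mulRoot (ζ : rootsOfUnity N ℂ) :
    Continuous (mulRoot ζ : RootSurface f N → RootSurface f N) :=
  Continuous.subtype_mk (continuous_proj.prodMk (continuous_const.mul continuous_root)) _

/-- The action of the `N`-th roots of unity on the root surface by deck transformations. -/
noncomputable def deck : rootsOfUnity N ℂ →* (RootSurface f N ≃ₜ RootSurface f N) :=
  MonoidHom.mk'
    (fun ζ =>
      { toFun := mulRoot ζ
        invFun := mulRoot ζ⁻¹
        left_inv := fun z => by rw [← mulRoot_mul, inv_mul_cancel, mulRoot_one]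
        right_inv := fun z => by rw [← mulRoot_mul, mul_inv_cancel, mulRoot_one]
        continuous_toFun := continuous_mulRoot ζ
        continuous_invFun := continuous_mulRoot ζ⁻¹ })
    fun ζ ξ => Homeomorph.ext (mulRoot_mul ζ ξ)

@[simp] lemma proj_deck (ζ : rootsOfUnity N ℂ) (z : RootSurface f N) :
    proj (deck ζ z) = proj z := rfl

@[simp] lemma root_deck (ζ : rootsOfUnity N ℂ) (z : RootSurface f N) :
    root (deck ζ z) = (ζ : ℂˣ) * root z := rfl

lemma exists_deck_eq (hN : N ≠ 0) {z z' : RootSurface f N} (h : proj z = proj z') :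
    ∃ ζ : rootsOfUnity N ℂ, deck ζ z = z' := by
  by_cases hz : root z = 0
  · exact ⟨1, by rw [map_one]; exact (eq_of_root_eq_zero hN hz h.symm).symm⟩
  have hp : root z' ^ N = root z ^ N := by rw [root_pow, root_pow, h]
  have hz' : root z' ≠ 0 := fun h0 => hz (by
    rw [h0, zero_pow hN] at hp
    exact (pow_eq_zero_iff hN).1 hp.symm)
  let u : ℂˣ := Units.mk0 (root z' / root z) (div_ne_zero hz' hz)
  have hu : u ∈ rootsOfUnity N ℂ := by
    rw [mem_rootsOfUnity']
    simp only [u, Units.val_mk0, div_pow, hp]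
    exact div_self (pow_ne_zero _ hz)
  exact ⟨⟨u, hu⟩, ext_proj_root h (by simp [u, hz])⟩

lemma deck_injective_of_root_ne_zero {z : RootSurface f N} (hz : root z ≠ 0) :
    Function.Injective fun ζ : rootsOfUnity N ℂ => deck ζ z := fun ζ ξ h => by
  have := congrArg root h
  simp only [root_deck] at this
  exact Subtype.ext (Units.ext (mul_right_cancel₀ hz this))

lemma deck_inv (ζ : rootsOfUnity N ℂ) :
    deck (f := f) ζ⁻¹ = (deck ζ).symm := map_inv deck ζ

lemma finite_fiber (hN : N ≠ 0) (y : Y) : (proj ⁻¹' {y} : Set (RootSurface f N)).Finite := by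
  have : NeZero N := ⟨hN⟩
  obtain ⟨z, rfl⟩ := proj_surjective (f := f) hN y
  exact (Set.finite_range fun ζ : rootsOfUnity N ℂ => deck ζ z).subset
    fun z' h => exists_deck_eq hN (Eq.symm h)

lemma ncard_fiber (hN : N ≠ 0) {y : Y} (hy : f y ≠ 0) :
    (proj ⁻¹' {y} : Set (RootSurface f N)).ncard = N := by
  have : NeZero N := ⟨hN⟩
  obtain ⟨z, rfl⟩ := proj_surjective (f := f) hN y
  have hz : root z ≠ 0 := fun h => hy ((root_eq_zero_iff hN z).1 h)
  have : (proj ⁻¹' {proj z} : Set (RootSurface f N)) =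
      range fun ζ : rootsOfUnity N ℂ => deck ζ z := by
    ext z'
    constructor
    · exact fun h => exists_deck_eq hN (Eq.symm h)
    · rintro ⟨ζ, rfl⟩
      rfl
  rw [this, ← Set.image_univ, Set.ncard_image_of_injective _ (deck_injective_of_root_ne_zero hz),
    Set.ncard_univ, Complex.card_rootsOfUnity]

/-- The root surface is connected as soon as `f` has a zero: a nonempty clopen set is mapped onto
`Y`, hence contains the only point over the zero. -/
lemma connectedSpace [T2Space Y] [CompactSpace Y] [ConnectedSpace Y] (hf : Continuous f)
    (hN : N ≠ 0) {p : Y} (hp : f p = 0) : ConnectedSpace (RootSurface f N) := by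
  have := compactSpace hf hN
  have hclosed : IsClosedMap (proj : RootSurface f N → Y) := continuous_proj.isClosedMap
  have hquot := hclosed.isQuotientMap continuous_proj (proj_surjective hN)
  obtain ⟨z₀, hz₀⟩ := proj_surjective (f := f) hN p
  have hr : root z₀ = 0 := (root_eq_zero_iff hN z₀).2 (by rw [hz₀, hp])
  have key : ∀ U : Set (RootSurface f N), IsClopen U → U.Nonempty → z₀ ∈ U := by
    intro U hU hne
    have hopen : IsOpen (proj '' U) := by
      rw [← hquot.isOpen_preimage]
      have : proj ⁻¹' (proj '' U) =
          ⋃ ζ : rootsOfUnity N ℂ, (deck ζ : RootSurface f N ≃ₜ RootSurface f N) ⁻¹' U := by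
        ext z
        simp only [mem_preimage, mem_image, mem_iUnion]
        constructor
        · rintro ⟨z', hz', h⟩
          obtain ⟨ζ, rfl⟩ := exists_deck_eq hN h.symm
          exact ⟨ζ, hz'⟩
        · rintro ⟨ζ, h⟩
          exact ⟨_, h, rfl⟩
      rw [this]
      exact isOpen_iUnion fun ζ => hU.2.preimage (deck ζ).continuous
    have huniv : proj '' U = univ := IsClopen.eq_univ ⟨hclosed _ hU.1, hopen⟩ (hne.image _)
    obtain ⟨z, hz, hzp⟩ := huniv.symm ▸ mem_univ (proj z₀)
    rwa [← eq_of_root_eq_zero hN hr hzp]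
  have : Nonempty (RootSurface f N) := ⟨z₀⟩
  have : PreconnectedSpace (RootSurface f N) := by
    refine preconnectedSpace_iff_clopen.2 fun U hU => ?_
    by_contra! h
    exact key Uᶜ hU.compl (nonempty_compl.2 h.2) (key U hU h.1)
  exact ⟨inferInstance⟩

lemma finite_range_rootsOfUnity (hN : N ≠ 0) :
    (range fun ζ : rootsOfUnity N ℂ => ((ζ : ℂˣ) : ℂ)).Finite := by
  have : NeZero N := ⟨hN⟩
  exact Set.finite_range _

/-- Every homeomorphism `h` of the root surface over `Y` is multiplication by a root of unity: the
quotient `root (h z) / root z` has finitely many values, so it is locally constant away from the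
zeros of `root`, and also near such a zero, because a punctured neighbourhood of it is connected. -/
lemma exists_eq_deck [ConnectedSpace (RootSurface f N)] [T2Space Y] (hN : N ≠ 0)
    (hloc : ∀ z : RootSurface f N, root z = 0 →
      ∃ U ∈ 𝓝 z, IsPreconnected (U \ {z}) ∧ ∀ z' ∈ U, root z' = 0 → z' = z)
    (hdense : Dense {z : RootSurface f N | root z ≠ 0})
    (h : RootSurface f N ≃ₜ RootSurface f N) (hh : ∀ z, proj (h z) = proj z) :
    ∃ ζ : rootsOfUnity N ℂ, deck ζ = h := by
  have hex : ∀ z, ∃ ζ : rootsOfUnity N ℂ, deck ζ z = h z := fun z =>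
    exists_deck_eq hN (hh z).symm
  let T : Set ℂ := range fun ζ : rootsOfUnity N ℂ => ((ζ : ℂˣ) : ℂ)
  have hT : T.Finite := finite_range_rootsOfUnity hN
  let r : RootSurface f N → ℂ := fun z => root (h z) / root z
  have hr : ∀ z, root z ≠ 0 → ∀ ζ : rootsOfUnity N ℂ, deck ζ z = h z ↔ r z = (ζ : ℂˣ) := by
    intro z hz ζ
    constructor
    · intro e
      simp only [r, ← e, root_deck]
      exact mul_div_cancel_right₀ _ hz
    · intro e
      refine ext_proj_root (hh z).symm ?_
      rw [root_deck, ← e]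
      exact div_mul_cancel₀ _ hz
  have hrT : ∀ z, root z ≠ 0 → r z ∈ T := fun z hz =>
    let ⟨ζ, hζ⟩ := hex z
    ⟨ζ, ((hr z hz ζ).1 hζ).symm⟩
  have hrc : ∀ z, root z ≠ 0 → ContinuousAt r z := fun z hz =>
    ((continuous_root.comp h.continuous).continuousAt).div continuous_root.continuousAt hz
  -- near every point, `h` is a single deck transformation
  have hlocal : ∀ z, ∃ ζ : rootsOfUnity N ℂ, ∀ᶠ z' in 𝓝 z, deck ζ z' = h z' := by
    intro z
    by_cases hz : root z = 0
    · obtain ⟨U, hU, hpre, hU0⟩ := hloc z hz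
      have hne : ∀ z' ∈ U \ {z}, root z' ≠ 0 := fun z' hz' h0 => hz'.2 (hU0 z' hz'.1 h0)
      have hsub : (r '' (U \ {z})).Subsingleton := by
        refine hT.countable.isTotallyDisconnected _ ?_ (hpre.image r fun z' hz' =>
          (hrc z' (hne z' hz')).continuousWithinAt)
        rintro _ ⟨z', hz', rfl⟩
        exact hrT z' (hne z' hz')
      obtain ⟨ζ, hζ⟩ : ∃ ζ : rootsOfUnity N ℂ, ∀ z' ∈ U \ {z}, deck ζ z' = h z' := by
        rcases (U \ {z}).eq_empty_or_nonempty with he | ⟨z₁, hz₁⟩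
        · exact ⟨1, fun z' hz' => absurd hz' (by simp [he])⟩
        · obtain ⟨ζ, hζ⟩ := hex z₁
          refine ⟨ζ, fun z' hz' => (hr z' (hne z' hz') ζ).2 ?_⟩
          rw [← (hr z₁ (hne z₁ hz₁) ζ).1 hζ]
          exact hsub ⟨z', hz', rfl⟩ ⟨z₁, hz₁, rfl⟩
      refine ⟨ζ, ?_⟩
      filter_upwards [hU] with z' hz'
      rcases eq_or_ne z' z with rfl | hzz
      · rw [eq_of_root_eq_zero hN hz (hh z'), eq_of_root_eq_zero hN hz (proj_deck ζ z')]
      · exact hζ z' ⟨hz', hzz⟩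
    · obtain ⟨ζ, hζ⟩ := hex z
      refine ⟨ζ, ?_⟩
      have h1 : ∀ᶠ z' in 𝓝 z, r z' ∈ (T \ {((ζ : ℂˣ) : ℂ)})ᶜ :=
        (hrc z hz).eventually ((hT.subset sdiff_subset).isClosed.isOpen_compl.mem_nhds
          (by simp [(hr z hz ζ).1 hζ]))
      filter_upwards [h1, continuous_root.continuousAt.eventually_ne hz] with z' h2 h3
      refine (hr z' h3 ζ).2 ?_
      by_contra hcon
      exact h2 ⟨hrT z' h3, hcon⟩
  let F : rootsOfUnity N ℂ → Set (RootSurface f N) := fun ζ => {z | ∀ᶠ z' in 𝓝 z, deck ζ z' = h z'}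
  have hFo : ∀ ζ, IsOpen (F ζ) := fun ζ => isOpen_setOfPred_eventually_nhds
  have hFd : ∀ ζ ξ z, z ∈ F ζ → z ∈ F ξ → ζ = ξ := by
    intro ζ ξ z h1 h2
    obtain ⟨z', ⟨h3, h4⟩, h5⟩ := hdense.inter_nhds_nonempty (h1.and h2) |>.imp fun _ => And.symm
    exact deck_injective_of_root_ne_zero h5 (h3.trans h4.symm)
  obtain ⟨z₀⟩ : Nonempty (RootSurface f N) := inferInstance
  obtain ⟨ζ, hζ⟩ := hlocal z₀
  refine ⟨ζ, Homeomorph.ext fun z => ?_⟩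
  have hclopen : IsClopen (F ζ) := by
    refine ⟨⟨?_⟩, hFo ζ⟩
    have : (F ζ)ᶜ = ⋃ ξ ∈ {ξ | ξ ≠ ζ}, F ξ := by
      ext z
      simp only [mem_compl_iff, mem_iUnion, mem_ofPred_eq, exists_prop]
      constructor
      · intro hz
        obtain ⟨ξ, hξ⟩ := hlocal z
        exact ⟨ξ, fun e => hz (e ▸ hξ), hξ⟩
      · rintro ⟨ξ, hne, hξ⟩ hz
        exact hne (hFd _ _ z hξ hz)
    rw [this]
    exact isOpen_biUnion fun ξ _ => hFo ξ
  have : z ∈ F ζ := (hclopen.eq_univ ⟨z₀, hζ⟩).symm ▸ mem_univ z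
  exact this.self_of_nhds

/-- A group of homeomorphisms over `Y` that contains the multiplications by the roots of unity
consists of these multiplications, so it is cyclic of order `N` and transitive on the fibres. -/
lemma isCyclicGalois [ConnectedSpace (RootSurface f N)] [T2Space Y] (hN : N ≠ 0)
    (hloc : ∀ z : RootSurface f N, root z = 0 →
      ∃ U ∈ 𝓝 z, IsPreconnected (U \ {z}) ∧ ∀ z' ∈ U, root z' = 0 → z' = z)
    (hdense : Dense {z : RootSurface f N | root z ≠ 0})
    {G : Subgroup (RootSurface f N ≃ₜ RootSurface f N)}
    (hG : ∀ h ∈ G, ∀ z, proj (h z) = proj z) (hdeck : ∀ ζ : rootsOfUnity N ℂ, deck ζ ∈ G) :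
    IsCyclicGalois (proj : RootSurface f N → Y) N G := by
  have : NeZero N := ⟨hN⟩
  refine ⟨?_, fun z z' h => ?_⟩
  · obtain ⟨z₀, hz₀⟩ := hdense.nonempty
    let d : rootsOfUnity N ℂ →* G := deck.codRestrict G hdeck
    have hinj : Function.Injective d := fun ζ ξ h =>
      deck_injective_of_root_ne_zero hz₀
        (congrArg (fun g : G => (g : RootSurface f N ≃ₜ RootSurface f N) z₀) h)
    have hsurj : Function.Surjective d := fun h =>
      let ⟨ζ, hζ⟩ := exists_eq_deck hN hloc hdense h.1 (hG h.1 h.2)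
      ⟨ζ, Subtype.ext hζ⟩
    refine ⟨(MulEquiv.ofBijective d ⟨hinj, hsurj⟩).symm.trans (mulEquivOfCyclicCardEq ?_)⟩
    rw [Nat.card_congr Multiplicative.toAdd, Nat.card_zmod, Complex.card_rootsOfUnity]
  · obtain ⟨ζ, hζ⟩ := exists_deck_eq hN h
    exact ⟨_, hdeck ζ, hζ⟩

end Topological

end RootSurface

namespace RootSurface

variable {Y : Type u} {f : Y → ℂ} {N : ℕ} [TopologicalSpace Y] [ChartedSpace Plane Y]

/-! ### The smooth structure of the root surface -/

/-- A chart `c` of the root surface is adapted if it is compatible with the inclusion of the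
surface in `Y × ℂ`: the inclusion is smooth in the coordinate `c`, and `c` extends locally to a
smooth function on `Y × ℂ`. -/
structure IsAdapted (c : OpenPartialHomeomorph (RootSurface f N) Plane) : Prop where
  proj_symm : ∀ v ∈ c.target, ContMDiffAt (𝓡 2) (𝓡 2) ∞ (proj ∘ c.symm) v
  root_symm : ∀ v ∈ c.target, ContMDiffAt (𝓡 2) 𝓘(ℝ, ℂ) ∞ (root ∘ c.symm) v
  exists_extension : ∀ z ∈ c.source, ∃ C : Y × ℂ → Plane,
    ContMDiffAt ((𝓡 2).prod 𝓘(ℝ, ℂ)) (𝓡 2) ∞ C z.1 ∧ ∀ᶠ z' in 𝓝 z, c z' = C z'.1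

/-- A map into the root surface whose two components are smooth is smooth in an adapted chart. -/
lemma IsAdapted.contMDiffAt_comp {c : OpenPartialHomeomorph (RootSurface f N) Plane}
    (hc : IsAdapted c) {E H M : Type*} [NormedAddCommGroup E] [NormedSpace ℝ E]
    [TopologicalSpace H] {I : ModelWithCorners ℝ E H} [TopologicalSpace M] [ChartedSpace H M]
    {g : M → RootSurface f N} {x : M} (hx : g x ∈ c.source) (hg : ContinuousAt g x)
    (h₁ : ContMDiffAt I (𝓡 2) ∞ (proj ∘ g) x) (h₂ : ContMDiffAt I 𝓘(ℝ, ℂ) ∞ (root ∘ g) x) :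
    ContMDiffAt I (𝓡 2) ∞ (c ∘ g) x := by
  obtain ⟨C, hC, hCe⟩ := hc.exists_extension _ hx
  have h3 : ContMDiffAt I (𝓡 2) ∞ (C ∘ fun m => (proj (g m), root (g m))) x :=
    ContMDiffAt.comp x (by exact hC) (h₁.prodMk h₂)
  exact h3.congr_of_eventuallyEq (hg.eventually hCe)

lemma contDiffAt_adapted_transition {c c' : OpenPartialHomeomorph (RootSurface f N) Plane}
    (hc : IsAdapted c) (hc' : IsAdapted c') {v : Plane} (hv : v ∈ c.target)
    (hv' : c.symm v ∈ c'.source) : ContDiffAt ℝ ∞ (c' ∘ c.symm) v :=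
  (hc'.contMDiffAt_comp hv' (c.continuousAt_symm hv) (hc.proj_symm v hv)
    (hc.root_symm v hv)).contDiffAt

/-- The root surface is covered by adapted charts. -/
class HasAdaptedCharts (f : Y → ℂ) (N : ℕ) : Prop where
  exists_chart : ∀ z : RootSurface f N, ∃ c : OpenPartialHomeomorph (RootSurface f N) Plane,
    IsAdapted c ∧ z ∈ c.source

variable [HasAdaptedCharts f N]

/-- The atlas of all adapted charts. -/
noncomputable instance : ChartedSpace Plane (RootSurface f N) where
  atlas := {c | IsAdapted c}
  chartAt z := (HasAdaptedCharts.exists_chart z).choose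
  mem_chart_source z := (HasAdaptedCharts.exists_chart z).choose_spec.2
  chart_mem_atlas z := (HasAdaptedCharts.exists_chart z).choose_spec.1

instance : IsManifold (𝓡 2) ∞ (RootSurface f N) := by
  refine isManifold_of_contDiffOn _ _ _ fun c c' hc hc' v hv => ?_
  simp only [mfld_simps] at hv
  exact (contDiffAt_adapted_transition hc hc' hv.1 hv.2).contDiffWithinAt

lemma IsAdapted.mem_maximalAtlas {c : OpenPartialHomeomorph (RootSurface f N) Plane}
    (hc : IsAdapted c) : c ∈ IsManifold.maximalAtlas (𝓡 2) ∞ (RootSurface f N) :=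
  IsManifold.subset_maximalAtlas hc

lemma isAdapted_chartAt (z : RootSurface f N) : IsAdapted (chartAt Plane z) :=
  chart_mem_atlas Plane z

lemma contMDiff_proj : ContMDiff (𝓡 2) (𝓡 2) ∞ (proj : RootSurface f N → Y) := by
  intro z
  have h1 := (isAdapted_chartAt z).proj_symm _ (mem_chart_target Plane z)
  have h2 := h1.comp z (contMDiffAt_of_mem_maximalAtlas
    (IsManifold.chart_mem_maximalAtlas (I := 𝓡 2) (n := ∞) z) (mem_chart_source Plane z))
  refine h2.congr_of_eventuallyEq ?_
  filter_upwards [(chartAt Plane z).open_source.mem_nhds (mem_chart_source Plane z)] with z' hz'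
  simp [(chartAt Plane z).left_inv hz']

lemma contMDiff_root : ContMDiff (𝓡 2) 𝓘(ℝ, ℂ) ∞ (root : RootSurface f N → ℂ) := by
  intro z
  have h1 := (isAdapted_chartAt z).root_symm _ (mem_chart_target Plane z)
  have h2 := h1.comp z (contMDiffAt_of_mem_maximalAtlas
    (IsManifold.chart_mem_maximalAtlas (I := 𝓡 2) (n := ∞) z) (mem_chart_source Plane z))
  refine h2.congr_of_eventuallyEq ?_
  filter_upwards [(chartAt Plane z).open_source.mem_nhds (mem_chart_source Plane z)] with z' hz'
  simp [(chartAt Plane z).left_inv hz']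

/-- A continuous map into the root surface is smooth if its two components are. -/
lemma contMDiff_of_components {g : RootSurface f N → RootSurface f N} (hg : Continuous g)
    (h₁ : ContMDiff (𝓡 2) (𝓡 2) ∞ (proj ∘ g)) (h₂ : ContMDiff (𝓡 2) 𝓘(ℝ, ℂ) ∞ (root ∘ g)) :
    ContMDiff (𝓡 2) (𝓡 2) ∞ g := by
  intro z
  have hs := mem_chart_source Plane (g z)
  have h3 := (isAdapted_chartAt (g z)).contMDiffAt_comp hs hg.continuousAt (h₁ z) (h₂ z)
  have h4 := (contMDiffAt_symm_of_mem_maximalAtlas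
    (IsManifold.chart_mem_maximalAtlas (I := 𝓡 2) (n := ∞) (g z))
    (mem_chart_target Plane (g z))).comp z h3
  refine h4.congr_of_eventuallyEq ?_
  filter_upwards [hg.continuousAt.preimage_mem_nhds
    ((chartAt Plane (g z)).open_source.mem_nhds hs)] with z' hz'
  exact ((chartAt Plane (g z)).left_inv hz').symm

lemma contMDiff_deck (ζ : rootsOfUnity N ℂ) :
    ContMDiff (𝓡 2) (𝓡 2) ∞ (deck ζ : RootSurface f N → RootSurface f N) :=
  contMDiff_of_components (deck ζ).continuous contMDiff_proj
    ((contDiff_const.mul contDiff_id).contMDiff.comp contMDiff_root)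

lemma deck_mem_aut (ζ : rootsOfUnity N ℂ) :
    deck ζ ∈ Aut (𝓡 2) ∞ (proj : RootSurface f N → Y) :=
  ⟨contMDiff_deck ζ, deck_inv (f := f) ζ ▸ contMDiff_deck ζ⁻¹, proj_deck ζ⟩

end RootSurface

/-! ### Charts of the root surface -/

lemma isPreconnected_ball_sdiff_center {E : Type*} [NormedAddCommGroup E] [InnerProductSpace ℝ E]
    (hE : 1 < Module.rank ℝ E) (c : E) {r : ℝ} (hr : 0 < r) :
    IsPreconnected (Metric.ball c r \ {c}) := by
  let b := OpenPartialHomeomorph.univBall c r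
  have hb : b 0 = c := OpenPartialHomeomorph.univBall_apply_zero c r
  have hinj : Function.Injective b := by
    intro u v h
    exact b.injOn (by simp [b]) (by simp [b]) h
  have : b '' {0}ᶜ = Metric.ball c r \ {c} := by
    have h1 : b '' univ = Metric.ball c r := by
      rw [← OpenPartialHomeomorph.univBall_target c hr, ← b.image_source_eq_target]
      simp [b]
    rw [compl_eq_univ_sdiff, image_sdiff hinj, h1, image_singleton, hb]
  rw [← this]
  exact (isConnected_compl_singleton_of_one_lt_rank hE 0).isPreconnected.image b
    (OpenPartialHomeomorph.continuous_univBall c r).continuousOn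

/-- Near a nonzero complex number the `N`-th power map has a smooth inverse. -/
lemma exists_local_root {N : ℕ} (hN : N ≠ 0) {w : ℂ} (hw : w ≠ 0) :
    ∃ R : OpenPartialHomeomorph ℂ ℂ, (∀ u, R u = u ^ N) ∧ w ∈ R.source ∧
      ∀ a ∈ R.target, ContDiffAt ℝ ∞ R.symm a := by
  have hd : ∀ u : ℂ, HasDerivAt (fun u : ℂ => u ^ N) (N * u ^ (N - 1)) u := fun u =>
    hasDerivAt_pow N u
  have hne : ∀ u : ℂ, u ≠ 0 → (N * u ^ (N - 1) : ℂ) ≠ 0 := fun u hu =>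
    mul_ne_zero (Nat.cast_ne_zero.2 hN) (pow_ne_zero _ hu)
  have hc : ContDiff ℂ ∞ (fun u : ℂ => u ^ N) := by fun_prop
  let R₀ := (hc.contDiffAt (x := w)).toOpenPartialHomeomorph _
    ((hd w).hasFDerivAt_equiv (hne w hw)) (by simp)
  refine ⟨R₀.restrOpen {0}ᶜ isOpen_compl_singleton, fun u => rfl,
    ⟨ContDiffAt.mem_toOpenPartialHomeomorph_source _ _ _, hw⟩, fun a ha => ?_⟩
  refine ContDiffAt.restrict_scalars ℝ (𝕜' := ℂ) ?_
  have hs := OpenPartialHomeomorph.map_target _ ha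
  exact OpenPartialHomeomorph.contDiffAt_symm_deriv _ (hne _ hs.2) ha (hd _) hc.contDiffAt

namespace RootSurface

variable {Y : Type u} {f : Y → ℂ} {N : ℕ} [TopologicalSpace Y] [ChartedSpace Plane Y]

/-- A smooth function `C` on an open subset `W` of `Y × ℂ` that has a smooth inverse `s` along the
root surface restricts to an adapted chart. -/
lemma exists_adapted_of_inverse (z₀ : RootSurface f N) (C : Y × ℂ → Plane) (W : Set (Y × ℂ))
    (hW : IsOpen W) (T : Set Plane) (hT : IsOpen T) (s : Plane → Y × ℂ)
    (hC : ∀ p ∈ W, ContMDiffAt ((𝓡 2).prod 𝓘(ℝ, ℂ)) (𝓡 2) ∞ C p)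
    (hs₁ : ∀ v ∈ T, ContMDiffAt (𝓡 2) (𝓡 2) ∞ (fun v => (s v).1) v)
    (hs₂ : ∀ v ∈ T, ContMDiffAt (𝓡 2) 𝓘(ℝ, ℂ) ∞ (fun v => (s v).2) v)
    (hCs : ∀ z : RootSurface f N, z.1 ∈ W → C z.1 ∈ T ∧ s (C z.1) = z.1)
    (hsC : ∀ v ∈ T, s v ∈ W ∧ (s v).2 ^ N = f (s v).1 ∧ C (s v) = v) :
    ∃ c : OpenPartialHomeomorph (RootSurface f N) Plane, IsAdapted c ∧
      c.source = {z | z.1 ∈ W} ∧ (∀ z, c z = C z.1) := by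
  classical
  let inv : Plane → RootSurface f N := fun v => if h : (s v).2 ^ N = f (s v).1 then ⟨s v, h⟩ else z₀
  have hinv : ∀ v ∈ T, (inv v).1 = s v := fun v hv =>
    congrArg Subtype.val (dif_pos (hsC v hv).2.1)
  let c : OpenPartialHomeomorph (RootSurface f N) Plane :=
    { toFun := fun z => C z.1
      invFun := inv
      source := {z | z.1 ∈ W}
      target := T
      map_source' := fun z hz => (hCs z hz).1
      map_target' := fun v hv => by
        change (inv v).1 ∈ W
        rw [hinv v hv]
        exact (hsC v hv).1
      left_inv' := fun z hz => Subtype.ext (by rw [hinv _ (hCs z hz).1, (hCs z hz).2])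
      right_inv' := fun v hv => by rw [hinv v hv, (hsC v hv).2.2]
      open_source := hW.preimage continuous_val
      open_target := hT
      continuousOn_toFun := fun z hz =>
        ((hC _ hz).continuousAt.comp continuous_val.continuousAt).continuousWithinAt
      continuousOn_invFun := by
        refine Topology.IsInducing.subtypeVal.continuousOn_iff.2 ?_
        refine ContinuousOn.congr (f := s) (fun v hv => ?_) hinv
        exact ((hs₁ v hv).continuousAt.prodMk (hs₂ v hv).continuousAt).continuousWithinAt }
  refine ⟨c, ⟨fun v hv => ?_, fun v hv => ?_, fun z hz => ?_⟩, rfl, fun z => rfl⟩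
  · refine (hs₁ v hv).congr_of_eventuallyEq ?_
    filter_upwards [hT.mem_nhds hv] with v' hv'
    exact congrArg Prod.fst (hinv v' hv')
  · refine (hs₂ v hv).congr_of_eventuallyEq ?_
    filter_upwards [hT.mem_nhds hv] with v' hv'
    exact congrArg Prod.snd (hinv v' hv')
  · exact ⟨C, hC _ hz, Eventually.of_forall fun z' => rfl⟩

/-- Where the root does not vanish, the charts of `Y` are charts of the root surface. -/
lemma exists_adapted_of_root_ne_zero (hN : N ≠ 0) (hf : ContMDiff (𝓡 2) 𝓘(ℝ, ℂ) ∞ f)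
    {e : OpenPartialHomeomorph Y Plane} (he : e ∈ IsManifold.maximalAtlas (𝓡 2) ∞ Y)
    {z : RootSurface f N} (hz : root z ≠ 0) (hze : proj z ∈ e.source) :
    ∃ c : OpenPartialHomeomorph (RootSurface f N) Plane, IsAdapted c ∧ z ∈ c.source ∧
      ∀ z' ∈ c.source, proj z' ∈ e.source ∧ c z' = e (proj z') := by
  obtain ⟨R, hR, hzR, hRs⟩ := exists_local_root hN hz
  have hfe : ∀ v ∈ e.target, ContMDiffAt (𝓡 2) 𝓘(ℝ, ℂ) ∞ (fun v => f (e.symm v)) v :=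
    fun v hv => (hf _).comp v (contMDiffAt_symm_of_mem_maximalAtlas he hv)
  obtain ⟨c, hc, hcs, hcC⟩ := exists_adapted_of_inverse z (fun p => e p.1)
    (e.source ×ˢ R.source) (e.open_source.prod R.open_source)
    (e.target ∩ (fun v => f (e.symm v)) ⁻¹' R.target)
    (ContinuousOn.isOpen_inter_preimage
      (fun v hv => (hfe v hv).continuousAt.continuousWithinAt) e.open_target R.open_target)
    (fun v => (e.symm v, R.symm (f (e.symm v))))
    (fun p hp => (contMDiffAt_of_mem_maximalAtlas he hp.1).comp p contMDiffAt_fst)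
    (fun v hv => contMDiffAt_symm_of_mem_maximalAtlas he hv.1)
    (fun v hv => ContMDiffAt.comp (g := R.symm) v (hRs _ hv.2).contMDiffAt (hfe v hv.1))
    (fun z' hz' => by
      have h1 : e.symm (e z'.1.1) = z'.1.1 := e.left_inv hz'.1
      have h2 : R z'.1.2 = f z'.1.1 := by rw [hR, z'.2]
      refine ⟨⟨e.map_source hz'.1, ?_⟩, ?_⟩
      · rw [mem_preimage, h1, ← h2]
        exact R.map_source hz'.2
      · rw [h1, ← h2, R.left_inv hz'.2])
    (fun v hv => by
      refine ⟨⟨e.map_target hv.1, R.map_target hv.2⟩, ?_, e.right_inv hv.1⟩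
      rw [← hR, R.right_inv hv.2])
  refine ⟨c, hc, ?_, fun z' hz' => ?_⟩
  · rw [hcs]
    exact ⟨hze, hzR⟩
  · rw [hcs] at hz'
    exact ⟨hz'.1, hcC z'⟩

/-- If `f` is a coordinate of `Y`, up to a real linear map `σ` that commutes with powers (in
practice the identity or complex conjugation), then the root is a coordinate of the root surface. -/
lemma exists_adapted_of_coordinate {e : OpenPartialHomeomorph Y Plane}
    (he : e ∈ IsManifold.maximalAtlas (𝓡 2) ∞ Y) {σ : ℂ ≃L[ℝ] ℂ}
    (hσ : ∀ (w : ℂ) (n : ℕ), σ (w ^ n) = σ w ^ n)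
    (hef : ∀ y ∈ e.source, planeEquiv (e y) = σ (f y))
    {z : RootSurface f N} (hze : proj z ∈ e.source) :
    ∃ c : OpenPartialHomeomorph (RootSurface f N) Plane, IsAdapted c ∧ z ∈ c.source ∧
      (∀ z', planeEquiv (c z') = σ (root z')) ∧
      ∀ z' ∈ c.source, proj z' ∈ e.source ∧ e (proj z') = planePow N (c z') := by
  have hpow : ∀ z' : RootSurface f N, proj z' ∈ e.source →
      planePow N (planeEquiv.symm (σ (root z'))) = e (proj z') := fun z' hz' => by
    rw [planePow, ContinuousLinearEquiv.apply_symm_apply, ← hσ, root_pow, ← hef _ hz',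
      ContinuousLinearEquiv.symm_apply_apply]
  obtain ⟨c, hc, hcs, hcC⟩ := exists_adapted_of_inverse z
    (fun p => planeEquiv.symm (σ p.2)) (e.source ×ˢ univ) (e.open_source.prod isOpen_univ)
    (planePow N ⁻¹' e.target) (e.open_target.preimage (contDiff_planePow N).continuous)
    (fun v => (e.symm (planePow N v), σ.symm (planeEquiv v)))
    (fun p hp => (planeEquiv.symm.contDiff.comp σ.contDiff).contMDiff.contMDiffAt.comp p
      contMDiffAt_snd)
    (fun v hv => (contMDiffAt_symm_of_mem_maximalAtlas he hv).comp v
      (contDiff_planePow N).contMDiff.contMDiffAt)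
    (fun v hv => (σ.symm.contDiff.comp planeEquiv.contDiff).contMDiff.contMDiffAt)
    (fun z' hz' => by
      have h1 : planePow N (planeEquiv.symm (σ z'.1.2)) = e z'.1.1 := hpow z' hz'.1
      refine ⟨?_, ?_⟩
      · rw [mem_preimage, h1]
        exact e.map_source hz'.1
      · rw [h1, e.left_inv hz'.1]
        simp)
    (fun v hv => by
      refine ⟨⟨e.map_target hv, mem_univ _⟩, σ.injective ?_, by simp⟩
      rw [hσ, ← hef _ (e.map_target hv), e.right_inv hv]
      simp [planePow])
  refine ⟨c, hc, ?_, fun z' => ?_, fun z' hz' => ?_⟩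
  · rw [hcs]
    exact ⟨hze, mem_univ _⟩
  · rw [hcC]
    exact planeEquiv.apply_symm_apply _
  · rw [hcs] at hz'
    refine ⟨hz'.1, ?_⟩
    rw [hcC]
    exact (hpow z' hz'.1).symm

end RootSurface
/-- A smooth chart is positive if its coordinate changes to the oriented atlas have positive
Jacobian determinant. -/
def IsPositiveChart {M : Type*} [TopologicalSpace M] [ChartedSpace Plane M]
    (o : SurfaceOrientation M) (e : OpenPartialHomeomorph M Plane) : Prop :=
  e ∈ IsManifold.maximalAtlas (𝓡 2) ∞ M ∧ ∀ e' ∈ o.charts, ∀ x ∈ e.source ∩ e'.source,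
    0 < (fderiv ℝ (e' ∘ e.symm) (e x)).det

/-- A smooth complex function with finitely many zeros which, near each zero, is up to complex
conjugation a positive coordinate. The map `σ` is the identity or complex conjugation; only its
compatibility with powers matters. -/
structure IsBranchFunction {Y : Type*} [TopologicalSpace Y] [ChartedSpace Plane Y]
    (o : SurfaceOrientation Y) (f : Y → ℂ) : Prop where
  contMDiff : ContMDiff (𝓡 2) 𝓘(ℝ, ℂ) ∞ f
  finite_zeros : {y | f y = 0}.Finite
  exists_coordinate : ∀ y, f y = 0 → ∃ e, IsPositiveChart o e ∧ y ∈ e.source ∧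
    ∃ σ : ℂ ≃L[ℝ] ℂ, (∀ (w : ℂ) (n : ℕ), σ (w ^ n) = σ w ^ n) ∧
      ∀ y' ∈ e.source, planeEquiv (e y') = σ (f y')

namespace IsBranchFunction

open RootSurface

variable {Y : Type u} {f : Y → ℂ} {N : ℕ} [TopologicalSpace Y] [ChartedSpace Plane Y]
  {o : SurfaceOrientation Y}

/-- A chart near a point where the root does not vanish that is read off from a positive chart. -/
lemma exists_chart_of_root_ne_zero (hf : IsBranchFunction o f) (hN : N ≠ 0)
    {z : RootSurface f N} (hz : root z ≠ 0) :
    ∃ c : OpenPartialHomeomorph (RootSurface f N) Plane, ∃ e ∈ o.charts, IsAdapted c ∧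
      z ∈ c.source ∧ ∀ z' ∈ c.source, proj z' ∈ e.source ∧ c z' = e (proj z') := by
  obtain ⟨e, he, hze⟩ := o.cover (proj z)
  obtain ⟨c, hc⟩ := exists_adapted_of_root_ne_zero hN hf.contMDiff (o.smooth he) hz hze
  exact ⟨c, e, he, hc⟩

/-- A chart near a zero of the root in which the projection is the `N`-th power map. -/
lemma exists_chart_of_root_eq_zero (hf : IsBranchFunction o f) (hN : N ≠ 0)
    {z : RootSurface f N} (hz : root z = 0) :
    ∃ c : OpenPartialHomeomorph (RootSurface f N) Plane, ∃ e, IsPositiveChart o e ∧ IsAdapted c ∧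
      z ∈ c.source ∧ (∀ z', c z' = 0 ↔ root z' = 0) ∧
      (∀ z' ∈ c.source, proj z' ∈ e.source ∧ e (proj z') = planePow N (c z')) := by
  obtain ⟨e, he, hze, σ, hσ, hσe⟩ := hf.exists_coordinate _ ((root_eq_zero_iff hN z).1 hz)
  obtain ⟨c, hc, hzc, hcr, hce⟩ := exists_adapted_of_coordinate (N := N) he.1 hσ hσe hze
  refine ⟨c, e, he, hc, hzc, fun z' => ?_, hce⟩
  rw [← map_eq_zero_iff _ planeEquiv.injective, hcr, map_eq_zero_iff _ σ.injective]

lemma hasAdaptedCharts (hf : IsBranchFunction o f) (hN : N ≠ 0) : HasAdaptedCharts f N := by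
  refine ⟨fun z => ?_⟩
  by_cases hz : root z = 0
  · obtain ⟨c, _, _, hc, hzc, _⟩ := hf.exists_chart_of_root_eq_zero hN hz
    exact ⟨c, hc, hzc⟩
  · obtain ⟨c, _, _, hc, hzc, _⟩ := hf.exists_chart_of_root_ne_zero hN hz
    exact ⟨c, hc, hzc⟩

lemma finite_root_eq_zero (hf : IsBranchFunction o f) (hN : N ≠ 0) :
    {z : RootSurface f N | root z = 0}.Finite := by
  refine Set.Finite.of_finite_image (f := proj) (hf.finite_zeros.subset ?_) ?_
  · rintro _ ⟨z, hz, rfl⟩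
    exact (root_eq_zero_iff hN z).1 hz
  · intro z hz z' _ h
    exact (eq_of_root_eq_zero hN hz h.symm).symm

/-- Read in a chart, the root has isolated zeros. -/
lemma eventually_root_ne_zero [T2Space Y] (hf : IsBranchFunction o f) (hN : N ≠ 0)
    {c : OpenPartialHomeomorph (RootSurface f N) Plane} {z : RootSurface f N} (hz : z ∈ c.source) :
    ∀ᶠ v in 𝓝[≠] (c z), v ∈ c.target ∧ root (c.symm v) ≠ 0 := by
  have h1 : ∀ᶠ z' in 𝓝 z, z' ∈ c.source ∧ (z' ≠ z → root z' ≠ 0) := by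
    have hfin := (hf.finite_root_eq_zero (N := N) hN).subset
      (sdiff_subset : {z : RootSurface f N | root z = 0} \ {z} ⊆ _)
    filter_upwards [c.open_source.mem_nhds hz, hfin.isClosed.isOpen_compl.mem_nhds (by simp)]
      with z' h2 h3
    exact ⟨h2, fun hne h0 => h3 ⟨h0, hne⟩⟩
  have ht := c.map_source hz
  have h2 : ∀ᶠ v in 𝓝 (c z), c.symm v ∈ c.source ∧ (c.symm v ≠ z → root (c.symm v) ≠ 0) :=
    (c.continuousAt_symm ht).eventually (by rwa [c.left_inv hz])
  filter_upwards [nhdsWithin_le_nhds h2, nhdsWithin_le_nhds (c.open_target.mem_nhds ht),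
    self_mem_nhdsWithin] with v h3 h4 h5
  refine ⟨h4, h3.2 fun he => h5 ?_⟩
  rw [mem_singleton_iff, ← he, c.right_inv h4]

lemma dense_root_ne_zero [T2Space Y] (hf : IsBranchFunction o f) (hN : N ≠ 0) :
    Dense {z : RootSurface f N | root z ≠ 0} := by
  intro z
  by_cases hz : root z = 0
  · obtain ⟨c, _, _, _, hzc, _⟩ := hf.exists_chart_of_root_eq_zero hN hz
    have h1 : Tendsto c.symm (𝓝[≠] (c z)) (𝓝 z) := by
      have := c.continuousAt_symm (c.map_source hzc)
      rw [ContinuousAt, c.left_inv hzc] at this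
      exact this.mono_left nhdsWithin_le_nhds
    exact mem_closure_of_tendsto h1 ((hf.eventually_root_ne_zero hN hzc).mono fun v hv => hv.2)
  · exact subset_closure hz

lemma exists_preconnected_punctured_nhds (hf : IsBranchFunction o f) (hN : N ≠ 0)
    {z : RootSurface f N} (hz : root z = 0) :
    ∃ U ∈ 𝓝 z, IsPreconnected (U \ {z}) ∧ ∀ z' ∈ U, root z' = 0 → z' = z := by
  obtain ⟨c, _, _, _, hzc, hc0, _⟩ := hf.exists_chart_of_root_eq_zero hN hz
  have hcz : c z = 0 := (hc0 z).2 hz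
  have h0 : (0 : Plane) ∈ c.target := hcz ▸ c.map_source hzc
  have hs0 : c.symm 0 = z := by rw [← hcz, c.left_inv hzc]
  obtain ⟨r, hr, hball⟩ := Metric.isOpen_iff.1 c.open_target 0 h0
  refine ⟨c.symm '' Metric.ball 0 r, ?_, ?_, ?_⟩
  · rw [← hs0]
    exact c.symm.image_mem_nhds h0 (Metric.ball_mem_nhds _ hr)
  · have : c.symm '' Metric.ball 0 r \ {z} = c.symm '' (Metric.ball 0 r \ {0}) := by
      rw [(c.symm.injOn.mono hball).image_sdiff_subset
        (singleton_subset_iff.2 (Metric.mem_ball_self hr)), image_singleton, hs0]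
    rw [this]
    refine (isPreconnected_ball_sdiff_center ?_ 0 hr).image _
      (c.continuousOn_symm.mono (sdiff_subset.trans hball))
    rw [← Module.finrank_eq_rank, finrank_euclideanSpace_fin]
    norm_num
  · rintro _ ⟨v, hv, rfl⟩ h
    have := (hc0 _).2 h
    rw [c.right_inv (hball hv)] at this
    rw [this, hs0]

lemma isLocalHomeomorphOn_proj (hf : IsBranchFunction o f) (hN : N ≠ 0) :
    IsLocalHomeomorphOn (proj : RootSurface f N → Y) (proj ⁻¹' {y | f y = 0}ᶜ) := by
  refine IsLocalHomeomorphOn.mk _ _ fun z hz => ?_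
  obtain ⟨c, e, _, _, hzc, hce⟩ := hf.exists_chart_of_root_ne_zero hN
    (fun h => hz ((root_eq_zero_iff hN z).1 h))
  refine ⟨c ≫ₕ e.symm, ?_, fun z' hz' => ?_⟩
  · rw [OpenPartialHomeomorph.trans_source]
    refine ⟨hzc, ?_⟩
    rw [mem_preimage, (hce z hzc).2]
    exact e.map_source (hce z hzc).1
  · rw [OpenPartialHomeomorph.trans_source] at hz'
    change proj z' = e.symm (c z')
    rw [(hce z' hz'.1).2, e.left_inv (hce z' hz'.1).1]

/-! ### Positive charts of the root surface -/

/-- An adapted chart is positive if the projection has positive Jacobian determinant in it, away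
from the ramification points. -/
def IsPositiveAdapted (o : SurfaceOrientation Y)
    (c : OpenPartialHomeomorph (RootSurface f N) Plane) : Prop :=
  IsAdapted c ∧ ∀ e ∈ o.charts, ∀ z ∈ c.source, proj z ∈ e.source → root z ≠ 0 →
    0 < (fderiv ℝ (e ∘ proj ∘ c.symm) (c z)).det

/-- If the projection reads `P` in the chart `c` and a positive chart `e` of `Y`, then its
Jacobian determinant has the sign of that of `P`. -/
lemma isPositiveAdapted_of_local_form {c : OpenPartialHomeomorph (RootSurface f N) Plane}
    (hc : IsAdapted c) {e : OpenPartialHomeomorph Y Plane} (he : IsPositiveChart o e)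
    {P : Plane → Plane} (hP : ContDiff ℝ ∞ P)
    (hce : ∀ z ∈ c.source, proj z ∈ e.source ∧ e (proj z) = P (c z))
    (hdet : ∀ z ∈ c.source, root z ≠ 0 → 0 < (fderiv ℝ P (c z)).det) :
    IsPositiveAdapted o c := by
  refine ⟨hc, fun e' he' z hz hze' hz0 => ?_⟩
  have h1 : e' ∘ proj ∘ c.symm =ᶠ[𝓝 (c z)] (e' ∘ e.symm) ∘ P := by
    filter_upwards [c.open_target.mem_nhds (c.map_source hz)] with v hv
    obtain ⟨h2, h3⟩ := hce _ (c.map_target hv)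
    rw [c.right_inv hv] at h3
    simp only [Function.comp_apply, ← h3, e.left_inv h2]
  obtain ⟨hze, hzP⟩ := hce z hz
  have h2 := (contDiffAt_transition he.1 (o.smooth he') hze hze').differentiableAt (by simp)
  rw [hzP] at h2
  rw [h1.fderiv_eq, fderiv_comp _ h2 (hP.differentiable (by simp) _)]
  have h3 := he.2 e' he' _ ⟨hze, hze'⟩
  rw [hzP] at h3
  exact (mul_pos h3 (hdet z hz hz0)).trans_eq (LinearMap.det_comp _ _).symm

lemma exists_isPositiveAdapted (hf : IsBranchFunction o f) (hN : N ≠ 0) (z : RootSurface f N) :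
    ∃ c : OpenPartialHomeomorph (RootSurface f N) Plane, IsPositiveAdapted o c ∧ z ∈ c.source := by
  by_cases hz : root z = 0
  · obtain ⟨c, e, he, hc, hzc, hc0, hce⟩ := hf.exists_chart_of_root_eq_zero hN hz
    exact ⟨c, isPositiveAdapted_of_local_form hc he (contDiff_planePow N) hce
      fun z' _ hz' => det_fderiv_planePow_pos hN (mt (hc0 z').1 hz'), hzc⟩
  · obtain ⟨c, e, he, hc, hzc, hce⟩ := hf.exists_chart_of_root_ne_zero hN hz
    refine ⟨c, isPositiveAdapted_of_local_form hc
      ⟨o.smooth he, fun e' he' x hx => o.compatible e he e' he' x hx⟩ contDiff_id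
      (fun z' hz' => ⟨(hce z' hz').1, (hce z' hz').2.symm⟩) fun z' _ _ => ?_, hzc⟩
    rw [fderiv_id]
    exact zero_lt_one.trans_eq LinearMap.det_id.symm

/-- A Jacobian determinant that is positive away from the ramification points is nonnegative. -/
lemma det_fderiv_nonneg [T2Space Y] (hf : IsBranchFunction o f) (hN : N ≠ 0)
    {c : OpenPartialHomeomorph (RootSurface f N) Plane} {z : RootSurface f N} (hz : z ∈ c.source)
    {F : RootSurface f N → Plane} (hF : ContDiffAt ℝ ∞ (F ∘ c.symm) (c z))
    (hpos : ∀ᶠ z' in 𝓝 z, root z' ≠ 0 → 0 < (fderiv ℝ (F ∘ c.symm) (c z')).det) :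
    0 ≤ (fderiv ℝ (F ∘ c.symm) (c z)).det := by
  have h1 : ContinuousAt (fun v => (fderiv ℝ (F ∘ c.symm) v).det) (c z) :=
    ContinuousLinearMap.continuous_det.continuousAt.comp
      (hF.fderiv_right (m := 0) (by simp)).continuousAt
  have h2 : ∀ᶠ v in 𝓝 (c z), root (c.symm v) ≠ 0 →
      0 < (fderiv ℝ (F ∘ c.symm) (c (c.symm v))).det :=
    (c.continuousAt_symm (c.map_source hz)).eventually (by rwa [c.left_inv hz])
  refine ge_of_tendsto (h1.tendsto.mono_left (nhdsWithin_le_nhds (s := {c z}ᶜ))) ?_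
  filter_upwards [nhdsWithin_le_nhds h2, hf.eventually_root_ne_zero hN hz] with v h3 h4
  have := h3 h4.2
  rw [c.right_inv h4.1] at this
  exact this.le

/-! ### The ramified covering and its orientation -/

section Smooth

variable [HasAdaptedCharts f N]

lemma hasRamificationIndex_of_root_eq_zero (hf : IsBranchFunction o f) (hN : N ≠ 0)
    {z : RootSurface f N} (hz : root z = 0) :
    HasRamificationIndex (proj : RootSurface f N → Y) z N := by
  obtain ⟨c, e, he, hc, hzc, hc0, hce⟩ := hf.exists_chart_of_root_eq_zero hN hz
  have hcz := (hc0 z).2 hz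
  refine ⟨Nat.one_le_iff_ne_zero.2 hN, c, hc.mem_maximalAtlas, e, he.1, hzc, (hce z hzc).1, hcz,
    ?_, ?_⟩
  · rw [(hce z hzc).2, hcz, planePow, map_zero, zero_pow hN, map_zero]
  · filter_upwards [c.open_source.mem_nhds hzc] with z' hz'
    rw [(hce z' hz').2, ← planeEquiv_apply, ← planeEquiv_apply, planePow,
      ContinuousLinearEquiv.apply_symm_apply]

lemma hasRamificationIndex_one [IsManifold (𝓡 2) ∞ Y] (hf : IsBranchFunction o f) (hN : N ≠ 0)
    {z : RootSurface f N} (hz : root z ≠ 0) :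
    HasRamificationIndex (proj : RootSurface f N → Y) z 1 := by
  obtain ⟨e, he, hze, he0⟩ := exists_centered_chart (proj z)
  obtain ⟨c, hc, hzc, hce⟩ := exists_adapted_of_root_ne_zero hN hf.contMDiff he hz hze
  refine ⟨le_rfl, c, hc.mem_maximalAtlas, e, he, hzc, hze, ?_, he0, ?_⟩
  · rw [(hce z hzc).2, he0]
  · filter_upwards [c.open_source.mem_nhds hzc] with z' hz'
    rw [(hce z' hz').2, pow_one]

lemma isRamifiedCovering [IsManifold (𝓡 2) ∞ Y] [T2Space Y] [CompactSpace Y]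
    (hf : IsBranchFunction o f) (hN : N ≠ 0) :
    IsRamifiedCovering (proj : RootSurface f N → Y) N where
  contMDiff := contMDiff_proj
  surjective := proj_surjective hN
  exists_index z := by
    by_cases hz : root z = 0
    · exact ⟨N, hf.hasRamificationIndex_of_root_eq_zero hN hz⟩
    · exact ⟨1, hf.hasRamificationIndex_one hN hz⟩
  covering := by
    have := compactSpace hf.contMDiff.continuous hN
    exact ⟨{y | f y = 0}, hf.finite_zeros,
      IsCoveringMapOn.of_isLocalHomeomorphOn continuous_proj (hf.isLocalHomeomorphOn_proj hN),
      fun y hy => ncard_fiber hN hy⟩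

lemma isTotallyRamifiedOver (hf : IsBranchFunction o f) (hN : N ≠ 0) {p : Y} (hp : f p = 0) :
    IsTotallyRamifiedOver (proj : RootSurface f N → Y) N p := by
  obtain ⟨z, rfl⟩ := proj_surjective (f := f) hN p
  have hz := (root_eq_zero_iff hN z).2 hp
  exact ⟨z, fiber_eq_singleton hN hz, hf.hasRamificationIndex_of_root_eq_zero hN hz⟩

/-- The orientation of the root surface for which the projection preserves orientation. -/
def orientation [T2Space Y] (hf : IsBranchFunction o f) (hN : N ≠ 0) :
    SurfaceOrientation (RootSurface f N) where
  charts := {c | IsPositiveAdapted o c}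
  smooth _ hc := hc.1.mem_maximalAtlas
  cover z := hf.exists_isPositiveAdapted hN z
  compatible c hc c' hc' z hz := by
    have hm := hc.1.mem_maximalAtlas
    have hm' := hc'.1.mem_maximalAtlas
    have hd := contDiffAt_transition hm hm' hz.1 hz.2
    refine lt_of_le_of_ne (hf.det_fderiv_nonneg hN hz.1 hd ?_)
      (right_ne_zero_of_mul_eq_one (det_transition_mul hm hm' hz.1 hz.2)).symm
    obtain ⟨e, he, hze⟩ := o.cover (proj z)
    filter_upwards [c.open_source.mem_nhds hz.1, c'.open_source.mem_nhds hz.2,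
      continuous_proj.continuousAt.preimage_mem_nhds (e.open_source.mem_nhds hze)]
      with z' h1 h2 h3 h4
    have hF : DifferentiableAt ℝ ((e ∘ proj) ∘ c'.symm) (c' z') := by
      have h5 : ContMDiffAt (𝓡 2) (𝓡 2) ∞ e ((proj ∘ c'.symm) (c' z')) :=
        contMDiffAt_of_mem_maximalAtlas (o.smooth he) (by simpa [c'.left_inv h2] using h3)
      exact (h5.comp (c' z') (hc'.1.proj_symm _ (c'.map_source h2))).contDiffAt.differentiableAt
        (by simp)
    have h6 := det_fderiv_transition hm hm' h1 h2 hF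
    have h7 := hc.2 e he z' h1 h3 h4
    have h8 := hc'.2 e he z' h2 h3 h4
    exact pos_of_mul_pos_right (h6 ▸ h7) h8.le

lemma isOrientationPreserving [T2Space Y] (hf : IsBranchFunction o f) (hN : N ≠ 0) :
    IsOrientationPreserving (hf.orientation (N := N) hN) o proj := by
  intro c hc e he z hz hze hne
  refine lt_of_le_of_ne ?_ hne.symm
  have h5 : ContMDiffAt (𝓡 2) (𝓡 2) ∞ e ((proj ∘ c.symm) (c z)) :=
    contMDiffAt_of_mem_maximalAtlas (o.smooth he) (by simpa [c.left_inv hz] using hze)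
  refine hf.det_fderiv_nonneg hN (F := e ∘ proj) hz
    (h5.comp (c z) (hc.1.proj_symm _ (c.map_source hz))).contDiffAt ?_
  filter_upwards [c.open_source.mem_nhds hz,
    continuous_proj.continuousAt.preimage_mem_nhds (e.open_source.mem_nhds hze)] with z' h1 h2 h3
  exact hc.2 e he z' h1 h2 h3

end Smooth

end IsBranchFunction

/-! ### Functions with prescribed simple zeros -/

lemma eventually_symm {Y : Type*} [TopologicalSpace Y]
    {e : OpenPartialHomeomorph Y Plane} {y : Y} (hy : y ∈ e.source)
    {p : Y → Prop} (hp : ∀ᶠ y' in 𝓝 y, p y') : ∀ᶠ v in 𝓝 (e y), p (e.symm v) :=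
  (e.continuousAt_symm (e.map_source hy)).eventually (by rwa [e.left_inv hy])

variable {Y : Type u} [TopologicalSpace Y] [ChartedSpace Plane Y]

/-- The differential of `f : Y → ℂ` at `y` is invertible, as seen in some smooth chart. -/
def IsRegularAt (f : Y → ℂ) (y : Y) : Prop :=
  ∃ e ∈ IsManifold.maximalAtlas (𝓡 2) ∞ Y, y ∈ e.source ∧
    ∃ L : Plane →L[ℝ] ℂ, Function.Injective L ∧ HasFDerivAt (f ∘ e.symm) L (e y)

lemma IsRegularAt.congr {f g : Y → ℂ} {y : Y} (hg : IsRegularAt g y)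
    (h : ∀ᶠ y' in 𝓝 y, f y' = g y') :
    IsRegularAt f y := by
  obtain ⟨e, he, hy, L, hL, hd⟩ := hg
  exact ⟨e, he, hy, L, hL, hd.congr_of_eventuallyEq (eventually_symm hy h)⟩

lemma contDiffAt_comp_symm {f : Y → ℂ} (hf : ContMDiff (𝓡 2) 𝓘(ℝ, ℂ) ∞ f)
    {e : OpenPartialHomeomorph Y Plane} (he : e ∈ IsManifold.maximalAtlas (𝓡 2) ∞ Y)
    {v : Plane} (hv : v ∈ e.target) : ContDiffAt ℝ ∞ (f ∘ e.symm) v :=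
  ((hf _).comp v (contMDiffAt_symm_of_mem_maximalAtlas he hv)).contDiffAt

lemma IsRegularAt.mul {f g : Y → ℂ} {y : Y} (hf : ContMDiff (𝓡 2) 𝓘(ℝ, ℂ) ∞ f) (hfy : f y ≠ 0)
    (hg : IsRegularAt g y) (hgy : g y = 0) : IsRegularAt (fun y => f y * g y) y := by
  obtain ⟨e, he, hy, L, hL, hd⟩ := hg
  have h1 := ((contDiffAt_comp_symm hf he (e.map_source hy)).differentiableAt
    (by simp)).hasFDerivAt.mul hd
  refine ⟨e, he, hy, _, ?_, h1⟩
  have key : ∀ (D : Plane →L[ℝ] ℂ) (u : Plane), (f y • L + (0 : ℂ) • D) u = f y * L u := by simp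
  intro u v huv
  simp only [Function.comp_apply, e.left_inv hy, hgy] at huv
  exact hL (mul_left_cancel₀ hfy ((key _ u).symm.trans (huv.trans (key _ v))))

/-- Near a regular zero, `f` or its complex conjugate is a positive coordinate. -/
lemma IsRegularAt.exists_coordinate [IsManifold (𝓡 2) ∞ Y] {f : Y → ℂ}
    (hf : ContMDiff (𝓡 2) 𝓘(ℝ, ℂ) ∞ f) {y : Y} (hr : IsRegularAt f y) (o : SurfaceOrientation Y) :
    ∃ e, IsPositiveChart o e ∧ y ∈ e.source ∧
      ∃ σ : ℂ ≃L[ℝ] ℂ, (∀ (w : ℂ) (n : ℕ), σ (w ^ n) = σ w ^ n) ∧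
        ∀ y' ∈ e.source, planeEquiv (e y') = σ (f y') := by
  obtain ⟨e₁, he₁, hy₁⟩ := o.cover y
  have hm₁ := o.smooth he₁
  let G (σ : ℂ ≃L[ℝ] ℂ) : Plane → Plane := (planeEquiv.symm ∘ σ ∘ f) ∘ e₁.symm
  have hG : ∀ σ, ∀ v ∈ e₁.target, ContDiffAt ℝ ∞ (G σ) v := fun σ v hv =>
    (planeEquiv.symm.contDiff.comp σ.contDiff).contDiffAt.comp v (contDiffAt_comp_symm hf hm₁ hv)
  have hv₁ := e₁.map_source hy₁
  have hdet : (fderiv ℝ (G (.refl ℝ ℂ)) (e₁ y)).det ≠ 0 := by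
    obtain ⟨e₀, he₀, hy₀, L, hL, hd⟩ := hr
    have h1 : HasFDerivAt ((planeEquiv.symm ∘ f) ∘ e₀.symm)
        ((planeEquiv.symm : ℂ →L[ℝ] Plane).comp L) (e₀ y) :=
      planeEquiv.symm.hasFDerivAt.comp _ hd
    change (fderiv ℝ ((planeEquiv.symm ∘ f) ∘ e₁.symm) (e₁ y)).det ≠ 0
    rw [det_fderiv_transition hm₁ he₀ hy₁ hy₀ h1.differentiableAt, h1.fderiv]
    refine mul_ne_zero (fun h0 => ?_) (left_ne_zero_of_mul_eq_one
      (det_transition_mul he₀ hm₁ hy₀ hy₁))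
    refine (LinearMap.bot_lt_ker_of_det_eq_zero h0).ne' (LinearMap.ker_eq_bot.2 ?_)
    exact planeEquiv.symm.injective.comp hL
  obtain ⟨σ, hσ, hpos⟩ : ∃ σ : ℂ ≃L[ℝ] ℂ, (∀ (w : ℂ) (n : ℕ), σ (w ^ n) = σ w ^ n) ∧
      0 < (fderiv ℝ (G σ) (e₁ y)).det := by
    rcases hdet.lt_or_gt with h | h
    · refine ⟨Complex.conjCLE, fun w n => map_pow (starRingEnd ℂ) w n, ?_⟩
      let K : Plane →L[ℝ] Plane := (planeEquiv.symm : ℂ →L[ℝ] Plane).comp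
        ((Complex.conjCLE : ℂ →L[ℝ] ℂ).comp (planeEquiv : Plane →L[ℝ] ℂ))
      have hK : K.det = -1 := by
        rw [← Complex.det_conjAe]
        exact LinearMap.det_conj Complex.conjAe.toLinearMap planeEquiv.symm.toLinearEquiv
      have h1 : G Complex.conjCLE = K ∘ G (.refl ℝ ℂ) := by
        funext v
        simp [G, K]
      have h2 := K.hasFDerivAt.comp (e₁ y)
        ((hG (.refl ℝ ℂ) _ hv₁).differentiableAt (by simp)).hasFDerivAt
      rw [h1, h2.fderiv]
      refine lt_of_lt_of_eq ?_ (LinearMap.det_comp _ _).symm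
      change 0 < K.det * (fderiv ℝ (G (.refl ℝ ℂ)) (e₁ y)).det
      rw [hK]
      linarith
    · exact ⟨.refl ℝ ℂ, fun _ _ => rfl, h⟩
  let R₀ : OpenPartialHomeomorph Plane Plane := (hG σ _ hv₁).toOpenPartialHomeomorph _
    (f' := ContinuousLinearMap.toContinuousLinearEquivOfDetNeZero _ hpos.ne')
    ((hG σ _ hv₁).differentiableAt (by simp)).hasFDerivAt (by simp)
  let V : Set Plane := e₁.target ∩ (fun v => (fderiv ℝ (G σ) v).det) ⁻¹' Ioi 0
  have hV : IsOpen V := by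
    refine ContinuousOn.isOpen_inter_preimage (fun v hv => ?_) e₁.open_target isOpen_Ioi
    exact (ContinuousLinearMap.continuous_det.continuousAt.comp
      ((hG σ v hv).fderiv_right (m := 0) (by simp)).continuousAt).continuousWithinAt
  let R := R₀.restrOpen V hV
  have hR : (R : Plane → Plane) = G σ := rfl
  have hRs : R.source ⊆ V := inter_subset_right
  have hmem : e₁ ≫ₕ R ∈ IsManifold.maximalAtlas (𝓡 2) ∞ Y :=
    trans_mem_maximalAtlas hm₁ R (fun v hv => hG σ v hv.1) fun v hv => (hRs hv.2).2.ne'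
  refine ⟨e₁ ≫ₕ R, ⟨hmem, ?_⟩, ?_, σ, hσ, ?_⟩
  · rintro e' he' x ⟨hx, hx'⟩
    have hx₁ : x ∈ e₁.source ∧ e₁ x ∈ R.source := by
      rwa [OpenPartialHomeomorph.trans_source] at hx
    have h1 : (e₁ ≫ₕ R) ∘ e₁.symm =ᶠ[𝓝 (e₁ x)] G σ := by
      filter_upwards [e₁.open_target.mem_nhds (e₁.map_source hx₁.1)] with v hv
      change R (e₁ (e₁.symm v)) = _
      rw [e₁.right_inv hv, hR]
    have h2 : 0 < (fderiv ℝ ((e₁ ≫ₕ R) ∘ e'.symm) (e' x)).det := by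
      rw [det_fderiv_transition (o.smooth he') hm₁ hx' hx₁.1, h1.fderiv_eq]
      · exact mul_pos (hRs hx₁.2).2 (o.compatible e' he' e₁ he₁ x ⟨hx', hx₁.1⟩)
      · exact h1.differentiableAt_iff.2 ((hG σ _ (e₁.map_source hx₁.1)).differentiableAt (by simp))
    exact pos_of_mul_pos_right
      ((det_transition_mul hmem (o.smooth he') hx hx').symm ▸ zero_lt_one) h2.le
  · rw [OpenPartialHomeomorph.trans_source]
    exact ⟨hy₁, ContDiffAt.mem_toOpenPartialHomeomorph_source _ _ _, hv₁, hpos⟩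
  · intro y' hy'
    rw [OpenPartialHomeomorph.trans_source] at hy'
    change planeEquiv (R (e₁ y')) = _
    rw [hR]
    simp [G, e₁.left_inv hy'.1]

/-- The polynomial map `(s, t) ↦ s (s + 2 a) + i t` of the plane, with simple zeros of opposite
orientation at `(0, 0)` and `(-2 a, 0)`. -/
noncomputable def dipole (a : ℝ) (v : Plane) : ℂ := ⟨v 0 * (v 0 + 2 * a), v 1⟩

lemma hasFDerivAt_dipole (a : ℝ) (v : Plane) : ∃ L : Plane →L[ℝ] ℂ,
    HasFDerivAt (dipole a) L v ∧ ∀ w, L w = ⟨(2 * v 0 + 2 * a) * w 0, w 1⟩ := by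
  have h0 : HasFDerivAt (fun v : Plane => v 0) (EuclideanSpace.proj 0 : Plane →L[ℝ] ℝ) v :=
    (EuclideanSpace.proj 0 : Plane →L[ℝ] ℝ).hasFDerivAt
  have h1 : HasFDerivAt (fun v : Plane => v 1) (EuclideanSpace.proj 1 : Plane →L[ℝ] ℝ) v :=
    (EuclideanSpace.proj 1 : Plane →L[ℝ] ℝ).hasFDerivAt
  have h2 := ((h0.mul (h0.add_const (2 * a))).smul_const (1 : ℂ)).add (h1.smul_const Complex.I)
  refine ⟨_, h2.congr_of_eventuallyEq (Eventually.of_forall fun w => ?_), fun w => ?_⟩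
  · simp [dipole, Complex.ext_iff]
  · simp [Complex.ext_iff]
    ring

lemma contDiff_dipole (a : ℝ) : ContDiff ℝ ∞ (dipole a) := by
  have : dipole a = fun v => (v 0 * (v 0 + 2 * a)) • (1 : ℂ) + v 1 • Complex.I := by
    funext v
    simp [dipole, Complex.ext_iff]
  rw [this]
  fun_prop

/-- A smooth function which is `1` away from a given neighbourhood of `p` and has exactly two
zeros, both regular, one of them at `p`: in a chart it interpolates between a dipole and `1`. -/
lemma exists_dipole_function [IsManifold (𝓡 2) ∞ Y] [T2Space Y] (p : Y) {U : Set Y} (hU : U ∈ 𝓝 p) :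
    ∃ g : Y → ℂ, ContMDiff (𝓡 2) 𝓘(ℝ, ℂ) ∞ g ∧ g p = 0 ∧ {y | g y = 0}.Finite ∧
      (∀ y, g y = 0 → IsRegularAt g y) ∧ ∀ y ∉ U, ∀ᶠ y' in 𝓝 y, g y' = 1 := by
  obtain ⟨b, -, hb⟩ := (SmoothBumpFunction.nhds_basis_tsupport (I := 𝓡 2) p).mem_iff.1 hU
  set e := chartAt Plane p with he
  have hm : e ∈ IsManifold.maximalAtlas (𝓡 2) ∞ Y := IsManifold.chart_mem_maximalAtlas p
  set a : ℝ := b.rIn / 3 with ha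
  have ha0 : 0 < a := div_pos b.rIn_pos (by norm_num)
  let g : Y → ℂ := fun y => 1 + b y • (dipole a (e y - e p) - 1)
  have hgsmooth : ContMDiff (𝓡 2) 𝓘(ℝ, ℂ) ∞ g := by
    refine contMDiff_const.add (b.contMDiff_smul fun y hy => ContMDiffAt.contMDiffWithinAt ?_)
    have h1 : ContDiff ℝ ∞ (fun v : Plane => dipole a (v - e p) - 1) :=
      ((contDiff_dipole a).comp (contDiff_id.sub contDiff_const)).sub contDiff_const
    exact h1.contMDiff.contMDiffAt.comp y (contMDiffAt_of_mem_maximalAtlas hm hy)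
  -- at a zero, the bump function is `1` and the dipole vanishes
  have hzero : ∀ y, g y = 0 → y ∈ e.source ∧ (e y - e p) 1 = 0 ∧
      ((e y - e p) 0 = 0 ∨ (e y - e p) 0 = -(2 * a)) := by
    intro y hy
    have hb0 : b y ≠ 0 := fun h0 => by simp [g, h0] at hy
    have hys : y ∈ e.source := b.support_subset_source hb0
    refine ⟨hys, ?_⟩
    obtain ⟨v, hv⟩ : ∃ v, v = e y - e p := ⟨_, rfl⟩
    have hy' : 1 + b y • (dipole a v - 1) = 0 := hv ▸ hy
    rw [← hv]
    have hre : 1 + b y * (v 0 * (v 0 + 2 * a) - 1) = 0 := by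
      simpa [dipole] using congrArg Complex.re hy'
    have hv1 : v 1 = 0 := by simpa [dipole, hb0] using congrArg Complex.im hy'
    refine ⟨hv1, ?_⟩
    have hnorm : dist (e y) (e p) = |v 0| := by
      rw [dist_eq_norm, ← hv, EuclideanSpace.norm_eq]
      simp [Fin.sum_univ_two, hv1, Real.sqrt_sq_eq_abs]
    have hle : |v 0| ≤ b.rIn := by
      by_contra! hlt
      have h1 : 0 < v 0 * (v 0 + 2 * a) := by
        rcases lt_abs.1 hlt with h | h <;> nlinarith
      have h2 := b.le_one (x := y)
      have h3 := lt_of_le_of_ne (b.nonneg (x := y)) hb0.symm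
      nlinarith
    have hb1 : b y = 1 := b.one_of_dist_le hys (hnorm.trans_le hle)
    rw [hb1] at hre
    have : v 0 * (v 0 + 2 * a) = 0 := by linarith
    rcases mul_eq_zero.1 this with h | h
    · exact Or.inl h
    · exact Or.inr (by linarith)
  refine ⟨g, hgsmooth, ?_, ?_, fun y hy => ?_, fun y hy => ?_⟩
  · simp [g, dipole, Complex.ext_iff]
  · refine ((Set.toFinite {e p, e p + !₂[-(2 * a), 0]}).image e.symm).subset fun y hy => ?_
    obtain ⟨hys, h1, h0⟩ := hzero y hy
    refine ⟨e y, ?_, e.left_inv hys⟩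
    rcases h0 with h0 | h0
    · refine Or.inl (sub_eq_zero.1 ?_)
      ext i
      fin_cases i
      · exact h0
      · exact h1
    · refine Or.inr (sub_eq_iff_eq_add'.1 ?_)
      ext i
      fin_cases i
      · simpa using h0
      · simpa using h1
  · obtain ⟨hys, h1, h0⟩ := hzero y hy
    obtain ⟨L, hL, hLw⟩ := hasFDerivAt_dipole a (e y - e p)
    refine ⟨e, hm, hys, L, ?_, ?_⟩
    · refine (injective_iff_map_eq_zero L).2 fun w hw => ?_
      rw [hLw] at hw
      have hw0 := congrArg Complex.re hw
      have hw1 := congrArg Complex.im hw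
      simp only [Complex.zero_re, Complex.zero_im] at hw0 hw1
      have hne : 2 * (e y - e p) 0 + 2 * a ≠ 0 := by
        rcases h0 with h0 | h0 <;> rw [h0]
        · linarith
        · intro h; linarith
      ext i
      fin_cases i
      · exact (mul_eq_zero.1 hw0).resolve_left hne
      · exact hw1
    · have hdist : dist (e y) (e p) < b.rIn := by
        rw [dist_eq_norm, EuclideanSpace.norm_eq]
        simp only [Fin.sum_univ_two, h1]
        rcases h0 with h0 | h0 <;> rw [h0] <;> simp
        · exact b.rIn_pos
        · rw [abs_of_pos ha0]; linarith
      have hb1 := eventually_symm hys (b.eventuallyEq_one_of_dist_lt hys (by simpa using hdist))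
      have h2 : HasFDerivAt (fun v => dipole a (v - e p)) L (e y) := by
        have h3 := hL.comp (e y) ((hasFDerivAt_id (e y)).sub_const (e p))
        rwa [ContinuousLinearMap.comp_id] at h3
      refine h2.congr_of_eventuallyEq ?_
      filter_upwards [hb1, e.open_target.mem_nhds (e.map_source hys)] with v hv hvt
      simp [g, hv, e.right_inv hvt]
  · filter_upwards [notMem_tsupport_iff_eventuallyEq.1 (fun h => hy (hb h))] with y' hy'
    simp [g, hy']

/-- Every finite set of points is contained in the zero set of a branch function. -/
lemma exists_isBranchFunction [IsManifold (𝓡 2) ∞ Y] [T2Space Y] (o : SurfaceOrientation Y)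
    {S : Set Y} (hS : S.Finite) : ∃ f : Y → ℂ, IsBranchFunction o f ∧ ∀ p ∈ S, f p = 0 := by
  suffices h : ∃ f : Y → ℂ, ContMDiff (𝓡 2) 𝓘(ℝ, ℂ) ∞ f ∧ {y | f y = 0}.Finite ∧
      (∀ y, f y = 0 → IsRegularAt f y) ∧ ∀ p ∈ S, f p = 0 by
    obtain ⟨f, hf, hfin, hreg, hp⟩ := h
    exact ⟨f, ⟨hf, hfin, fun y hy => (hreg y hy).exists_coordinate hf o⟩, hp⟩
  induction S, hS using Set.Finite.induction_on with
  | empty => exact ⟨fun _ => 1, contMDiff_const, by simp, by simp, by simp⟩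
  | @insert p S _ _ ih =>
    obtain ⟨f, hf, hfin, hreg, hS⟩ := ih
    by_cases hp : f p = 0
    · exact ⟨f, hf, hfin, hreg, by simpa [hp] using hS⟩
    obtain ⟨g, hg, hgp, hgfin, hgreg, hg1⟩ :=
      exists_dipole_function p (hf.continuous.continuousAt.eventually_ne hp)
    refine ⟨fun y => f y * g y, ?_, ?_, ?_, ?_⟩
    · exact (contDiff_mul (𝕜 := ℝ) (𝔸 := ℂ)).contMDiff.comp (hf.prodMk_space hg)
    · exact (hfin.union hgfin).subset fun y hy => mul_eq_zero.1 hy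
    · intro y hy
      by_cases hfy : f y = 0
      · refine (hreg y hfy).congr ?_
        filter_upwards [hg1 y (by simpa using hfy)] with y' hy'
        rw [hy', mul_one]
      · have hgy := (mul_eq_zero.1 hy).resolve_left hfy
        exact (hgreg y hgy).mul hf hfy hgy
    · rintro y (rfl | hy)
      · simp [hgp]
      · simp [hS y hy]

/-! ### Homeomorphisms over a holomorphic map -/

/-- A continuous solution `H` of `g ∘ H = f`, injective at `c` and with `g` nonconstant near `H c`,
is holomorphic: away from `c` this is the inverse function theorem, since `g'` has isolated zeros,
and the singularity at `c` is removable. -/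
lemma analyticAt_of_comp_eq {f g H : ℂ → ℂ} {c : ℂ} (hf : AnalyticAt ℂ f c)
    (hg : AnalyticAt ℂ g (H c)) (hH : ∀ᶠ v in 𝓝 c, ContinuousAt H v)
    (hinj : ∀ᶠ v in 𝓝[≠] c, H v ≠ H c) (hgH : ∀ᶠ v in 𝓝 c, g (H v) = f v)
    (hconst : ¬ ∀ᶠ w in 𝓝 (H c), g w = g (H c)) : AnalyticAt ℂ H c := by
  have hd : ∀ᶠ w in 𝓝[≠] (H c), deriv g w ≠ 0 := by
    refine hg.deriv.eventually_eq_zero_or_eventually_ne_zero.resolve_left fun h0 => hconst ?_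
    obtain ⟨r, hr, hball⟩ := Metric.eventually_nhds_iff_ball.1
      (h0.and (hg.eventually_analyticAt.mono fun w hw => hw.differentiableAt))
    filter_upwards [Metric.ball_mem_nhds _ hr] with w hw
    refine (convex_ball (H c) r).is_const_of_fderivWithin_eq_zero (𝕜 := ℂ)
      (fun x hx => (hball x hx).2.differentiableWithinAt) (fun x hx => ?_) hw
      (Metric.mem_ball_self hr)
    rw [fderivWithin_of_isOpen Metric.isOpen_ball hx]
    ext
    simpa using (hball x hx).1
  have hcont := hH.self_of_nhds
  refine Complex.analyticAt_of_differentiable_on_punctured_nhds_of_continuousAt ?_ hcont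
  have h1 : ∀ᶠ v in 𝓝[≠] c, deriv g (H v) ≠ 0 := by
    refine (tendsto_nhdsWithin_iff.2 ⟨hcont.tendsto.mono_left nhdsWithin_le_nhds, hinj⟩).eventually
      hd
  filter_upwards [h1, nhdsWithin_le_nhds hH, nhdsWithin_le_nhds hgH.eventually_nhds,
    nhdsWithin_le_nhds hf.eventually_analyticAt,
    nhdsWithin_le_nhds (hcont.eventually hg.eventually_analyticAt)] with v h2 h3 h4 h5 h6
  have hs : HasStrictDerivAt g (deriv g (H v)) (H v) :=
    h6.hasStrictDerivAt
  have h7 : ∀ᶠ v' in 𝓝 v, hs.localInverse g _ _ h2 (f v') = H v' := by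
    filter_upwards [h4, h3.eventually (hs.eventually_left_inverse h2)] with v' h8 h9
    rw [← h8, h9]
  refine DifferentiableAt.congr_of_eventuallyEq (f := hs.localInverse g _ _ h2 ∘ f) ?_
    (h7.mono fun _ h => h.symm)
  refine DifferentiableAt.comp v ?_ h5.differentiableAt
  rw [← h4.self_of_nhds]
  exact (hs.to_localInverse h2).hasDerivAt.differentiableAt

/-- A homeomorphism over a holomorphic map with finite fibres is holomorphic. -/
lemma contMDiff_of_comp_eq {Z Y : Type*} [TopologicalSpace Z] [TopologicalSpace Y]
    [ChartedSpace ℂ Z] [ChartedSpace ℂ Y] {φ : Z → Y} (hφ : ContMDiff 𝓘(ℂ) 𝓘(ℂ) ω φ)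
    (hfin : ∀ y, (φ ⁻¹' {y}).Finite) (h : Z ≃ₜ Z) (hh : ∀ z, φ (h z) = φ z) :
    ContMDiff 𝓘(ℂ) 𝓘(ℂ) ω h := by
  intro z
  refine contMDiffAt_iff.2 ⟨h.continuous.continuousAt, ?_⟩
  have hφz := (contMDiffAt_iff.1 (hφ z)).2
  have hφh := (contMDiffAt_iff.1 (hφ (h z))).2
  rw [hh z] at hφh
  simp only [mfld_simps, contDiffWithinAt_univ] at hφz hφh ⊢
  set a := chartAt ℂ z
  set b := chartAt ℂ (h z)
  set e := chartAt ℂ (φ z)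
  have haz : z ∈ a.source := mem_chart_source ℂ z
  have hbz : h z ∈ b.source := mem_chart_source ℂ (h z)
  have hez : φ z ∈ e.source := mem_chart_source ℂ (φ z)
  have hsymm : a.symm (a z) = z := a.left_inv haz
  have hHc : (b ∘ h ∘ a.symm) (a z) = b (h z) := by simp [hsymm]
  -- the points near `a z` at which all the charts involved are defined
  have hnear : ∀ᶠ v in 𝓝 (a z), v ∈ a.target ∧ h (a.symm v) ∈ b.source := by
    have h1 : Tendsto a.symm (𝓝 (a z)) (𝓝 z) := by
      simpa [ContinuousAt, hsymm] using a.continuousAt_symm (a.map_source haz)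
    filter_upwards [a.open_target.mem_nhds (a.map_source haz),
      ((h.continuous.tendsto z).comp h1).eventually (b.open_source.mem_nhds hbz)] with v h2 h3
    exact ⟨h2, h3⟩
  refine AnalyticAt.contDiffAt ?_
  refine analyticAt_of_comp_eq (f := e ∘ φ ∘ a.symm) (g := e ∘ φ ∘ b.symm) hφz.analyticAt
    (hHc ▸ hφh.analyticAt) ?_ ?_ ?_ ?_
  · filter_upwards [hnear] with v hv
    have h1 : ContinuousAt (h ∘ a.symm) v :=
      h.continuous.continuousAt.comp (a.continuousAt_symm hv.1)
    exact ContinuousAt.comp (g := b) (b.continuousAt hv.2) h1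
  · filter_upwards [nhdsWithin_le_nhds hnear, self_mem_nhdsWithin] with v hv hne heq
    rw [hHc] at heq
    have h1 := h.injective (b.injOn hv.2 hbz heq)
    exact hne (by rw [mem_singleton_iff, ← h1, a.right_inv hv.1])
  · filter_upwards [hnear] with v hv
    simp [b.left_inv hv.2, hh]
  · rw [hHc]
    intro hconst
    -- otherwise a whole neighbourhood of `h z` is contained in one fibre
    have h1 : ∀ᶠ w in 𝓝 (b (h z)), w ∈ b.target ∧ φ (b.symm w) ∈ e.source := by
      have hb : Tendsto b.symm (𝓝 (b (h z))) (𝓝 (h z)) := by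
        simpa [ContinuousAt, b.left_inv hbz] using b.continuousAt_symm (b.map_source hbz)
      filter_upwards [b.open_target.mem_nhds (b.map_source hbz),
        ((hφ.continuous.tendsto (h z)).comp hb).eventually
          (e.open_source.mem_nhds ((hh z).symm ▸ hez))] with w h2 h3
      exact ⟨h2, h3⟩
    have h2 : {w | w ∈ b.target ∧ b.symm w ∈ φ ⁻¹' {φ z}} ∈ 𝓝 (b (h z)) := by
      filter_upwards [h1, hconst] with w h3 h4
      refine ⟨h3.1, e.injOn h3.2 hez ?_⟩
      simpa [b.left_inv hbz, hh] using h4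
    refine infinite_of_mem_nhds _ h2 (Set.Finite.of_finite_image (f := b.symm)
      ((hfin (φ z)).subset ?_) (b.symm.injOn.mono fun w hw => hw.1))
    rintro _ ⟨w, hw, rfl⟩
    exact hw.2

end RamifiedCovering

open RamifiedCovering in
theorem lemma2p1 (Y : Type u) [TopologicalSpace Y] [T2Space Y] [CompactSpace Y] [ConnectedSpace Y]
    [ChartedSpace Plane Y] [IsManifold (𝓡 2) ∞ Y] (oY : SurfaceOrientation Y)
    (S : Set Y) (hS : S.Finite) (N : ℕ) (hN : 2 ≤ N) :
    ∃ (Z : Type u) (_ : TopologicalSpace Z) (_ : T2Space Z) (_ : CompactSpace Z)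
      (_ : ConnectedSpace Z) (_ : ChartedSpace Plane Z) (_ : IsManifold (𝓡 2) ∞ Z)
      (oZ : SurfaceOrientation Z) (φ : Z → Y),
      IsRamifiedCovering φ N ∧
      IsOrientationPreserving oZ oY φ ∧
      (∀ p ∈ S, IsTotallyRamifiedOver φ N p) ∧
      -- the group of diffeomorphisms of `Z` over `Y`
      IsCyclicGalois φ N (Aut (𝓡 2) ∞ φ) ∧
      -- the group of holomorphic automorphisms of `Z` over `Y`, for all complex structures
      -- on `Z` and `Y` that make `φ` holomorphic
      ∀ (_ : ChartedSpace ℂ Z) (_ : ChartedSpace ℂ Y) (_ : IsManifold 𝓘(ℂ) ω Z)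
        (_ : IsManifold 𝓘(ℂ) ω Y), ContMDiff 𝓘(ℂ) 𝓘(ℂ) ω φ →
        IsCyclicGalois φ N (Aut 𝓘(ℂ) ω φ) := by
  have hN0 : N ≠ 0 := by lia
  -- adding a point to `S` guarantees a point of total ramification, which makes `Z` connected
  obtain ⟨p₀⟩ : Nonempty Y := inferInstance
  obtain ⟨f, hf, hfS⟩ := exists_isBranchFunction oY (hS.insert p₀)
  have hcont := hf.contMDiff.continuous
  have := RootSurface.compactSpace hcont hN0
  have := RootSurface.connectedSpace hcont hN0 (hfS p₀ (mem_insert _ _))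
  have := hf.hasAdaptedCharts hN0
  have hgalois := fun G => RootSurface.isCyclicGalois (G := G) hN0
    (fun _ hz => hf.exists_preconnected_punctured_nhds hN0 hz) (hf.dense_root_ne_zero hN0)
  refine ⟨RootSurface f N, inferInstance, inferInstance, inferInstance, inferInstance,
    inferInstance, inferInstance, hf.orientation hN0, RootSurface.proj,
    hf.isRamifiedCovering hN0, hf.isOrientationPreserving hN0,
    fun p hp => hf.isTotallyRamifiedOver hN0 (hfS p (mem_insert_of_mem _ hp)),
    hgalois _ (fun h hh => hh.2.2) RootSurface.deck_mem_aut, fun _ _ _ _ hφ => ?_⟩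
  have hhol : ∀ ζ : rootsOfUnity N ℂ,
      ContMDiff 𝓘(ℂ) 𝓘(ℂ) ω (RootSurface.deck (f := f) ζ) := fun ζ =>
    contMDiff_of_comp_eq hφ (RootSurface.finite_fiber hN0) _ (RootSurface.proj_deck ζ)
  refine hgalois _ (fun h hh => hh.2.2) fun ζ => ⟨hhol ζ, ?_, RootSurface.proj_deck ζ⟩
  rw [← RootSurface.deck_inv]
  exact hhol ζ⁻¹
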